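/- Let $d\ge 1$ and let $\alpha_1,\beta_1,\dots,\alpha_d,\beta_d>-1$ be real. Then the product Jacobi measure $$\mu(dx)=\prod_{j=1}^d(1-x_j)^{\alpha_j}(1+x_j)^{\beta_j}\mathbf 1_{[-1,1]}(x_j)\,dx_j$$ on $\mathbb R^d$ has the following properties. 1. It is a finite Borel measure supported inside $[-1,1]^d$ with a product density $\omega(x)=\omega_1(x_1)\cdots\omega_d(x_d)$, where each $\omega_j\ge 0$ is measurable. 2. Its multivariate orthonormal polynomials are well defined: for every non-zero polynomial $P$ the function $P^2$ is $\mu$-integrable and $\int P^2\,d\mu>0$. 3. The density $\omega$ is $\mathscr C^1$ and positive on the open cube $(-1,1)^d$. 4. (Regularity assumption.) Order the multi-indices in $\mathbb N^d$ first by their largest entry and then lexicographically, let $(\phi_k)_{k\in\mathbb N}$ be the orthonormal polynomials obtained by applying the Gram–Schmidt algorithm in $L^2(\mu)$ to the monomials $x_1^{k_1}\cdots x_d^{k_d}$ in this order, and let $K_N(x,y)=\sum_{k=0}^{N-1}\phi_k(x)\phi_k(y)$. With the Euclidean norm $\|\cdot\|$, set $$\mathscr D_N(x,y)=\frac{N/K_N(x,x)-N/K_N(y,y)}{\|x-y\|},\qquad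 Q_N(dx,dy)=\frac{1}{N^{1-1/d}}\|x-y\|^2K_N(x,y)^2\,\mu(dx)\,\mu(dy).$$ Then for every $0<\epsilon<1$, with $I_\epsilon^d=[-1+\epsilon,1-\epsilon]^d$, $$\lim_{C\to\infty}\ \limsup_{\delta\to0^+}\ \limsup_{N\to\infty}\iint_{x,y\in I_\epsilon^d,\ \|x-y\|\le\delta}\mathbf 1_{|\mathscr D_N(x,y)|>C}\ \mathscr D_N(x,y)^2\ Q_N(dx,dy)=0 .$$ -/

import Mathlib

open MeasureTheory Filter Topology
open scoped ENNReal

noncomputable section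

namespace JacobiOPE

/-- The closed cube with sides `[-1 + ε, 1 - ε]`; for `ε = 0` this is the cube `[-1, 1]ᵈ`. -/
def cube (d : ℕ) (ε : ℝ) : Set (EuclideanSpace ℝ (Fin d)) :=
  {x | ∀ j, x j ∈ Set.Icc (-1 + ε) (1 - ε)}

/-- The open cube `(-1, 1)ᵈ`. -/
def openCube (d : ℕ) : Set (EuclideanSpace ℝ (Fin d)) :=
  {x | ∀ j, x j ∈ Set.Ioo (-1 : ℝ) 1}

/-! ### The graded lexicographic order on multi-indices -/

/-- Comparing the values of this key compares two multi-indices first by their largest entry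
and then lexicographically. -/
def gradedKey (d : ℕ) (a : Fin d → ℕ) : ℕ ×ₗ Lex (Fin d → ℕ) :=
  toLex (Finset.univ.sup a, toLex a)

/-- The increasing enumeration of all multi-indices: the `n`-th one is the least multi-index
that is not among the previous ones. -/
def gradedIndex (d : ℕ) [NeZero d] (n : ℕ) : Fin d → ℕ :=
  Function.argminOn (gradedKey d) (Set.range fun k : Fin n => gradedIndex d k.1)ᶜ
    (Set.finite_range _).infinite_compl.nonempty
termination_by n
decreasing_by all_goals exact k.2

/-! ### Multivariate orthonormal polynomials and the Christoffel-Darboux kernel -/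

variable {d : ℕ}

/-- The value of a polynomial at a point. -/
def polyEval (P : MvPolynomial (Fin d) ℝ) (x : EuclideanSpace ℝ (Fin d)) : ℝ :=
  MvPolynomial.eval (fun j => x j) P

/-- The bilinear form `(P, Q) ↦ ∫ P Q dμ`. -/
def polyInner (μ : Measure (EuclideanSpace ℝ (Fin d))) (P Q : MvPolynomial (Fin d) ℝ) : ℝ :=
  ∫ x, polyEval P x * polyEval Q x ∂μ

/-- The monomial with the `n`-th multi-index in the graded lexicographic order. -/
def gradedMonomial (d : ℕ) [NeZero d] (n : ℕ) : MvPolynomial (Fin d) ℝ :=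
  ∏ j, MvPolynomial.X j ^ gradedIndex d n j

/-- The Gram-Schmidt algorithm (before normalization) applied to the ordered monomials. -/
def orthogonalPoly [NeZero d] (μ : Measure (EuclideanSpace ℝ (Fin d))) (n : ℕ) :
    MvPolynomial (Fin d) ℝ :=
  gradedMonomial d n - ∑ k : Fin n,
    (polyInner μ (gradedMonomial d n) (orthogonalPoly μ k.1) /
      polyInner μ (orthogonalPoly μ k.1) (orthogonalPoly μ k.1)) • orthogonalPoly μ k.1
termination_by n
decreasing_by all_goals exact k.2

/-- The multivariate orthonormal polynomials of `μ`. -/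
def orthonormalPoly [NeZero d] (μ : Measure (EuclideanSpace ℝ (Fin d))) (n : ℕ) :
    MvPolynomial (Fin d) ℝ :=
  (√(polyInner μ (orthogonalPoly μ n) (orthogonalPoly μ n)))⁻¹ • orthogonalPoly μ n

/-- The Christoffel-Darboux kernel `K_N(x, y)`. -/
def cdKernel [NeZero d] (μ : Measure (EuclideanSpace ℝ (Fin d))) (N : ℕ)
    (x y : EuclideanSpace ℝ (Fin d)) : ℝ :=
  ∑ k ∈ Finset.range N, polyEval (orthonormalPoly μ k) x * polyEval (orthonormalPoly μ k) y

/-! ### The regularity assumption -/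

/-- The rate of change `𝒟_N(x, y)` of `x ↦ N / K_N(x, x)`. -/
def rateOfChange [NeZero d] (μ : Measure (EuclideanSpace ℝ (Fin d))) (N : ℕ)
    (x y : EuclideanSpace ℝ (Fin d)) : ℝ :=
  (N / cdKernel μ N x x - N / cdKernel μ N y y) / ‖x - y‖

/-- The measure `Q_N(dx, dy) = N^{-(1 - 1/d)} ‖x - y‖² K_N(x, y)² μ(dx) μ(dy)`. -/
def pairMeasure [NeZero d] (μ : Measure (EuclideanSpace ℝ (Fin d))) (N : ℕ) :
    Measure (EuclideanSpace ℝ (Fin d) × EuclideanSpace ℝ (Fin d)) :=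
  (μ.prod μ).withDensity fun z => ENNReal.ofReal
    (1 / (N : ℝ) ^ (1 - 1 / (d : ℝ)) * ‖z.1 - z.2‖ ^ 2 * cdKernel μ N z.1 z.2 ^ 2)

/-- The integral of `1_{|𝒟_N| > C} 𝒟_N²` with respect to `Q_N` over the pairs of points of the
cube `[-1 + ε, 1 - ε]ᵈ` at distance at most `δ`. -/
def truncatedEnergy [NeZero d] (μ : Measure (EuclideanSpace ℝ (Fin d))) (ε C δ : ℝ) (N : ℕ) :
    ℝ≥0∞ :=
  ∫⁻ z in {z | z.1 ∈ cube d ε ∧ z.2 ∈ cube d ε ∧ ‖z.1 - z.2‖ ≤ δ},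
    {z | C < |rateOfChange μ N z.1 z.2|}.indicator
      (fun z => ENNReal.ofReal (rateOfChange μ N z.1 z.2 ^ 2)) z ∂(pairMeasure μ N)

/-- The regularity assumption: local uniform integrability of the squared rate of change of
`N / K_N(x, x)` with respect to the measures `Q_N`, away from the boundary of the cube. -/
def RegularityAssumption [NeZero d] (μ : Measure (EuclideanSpace ℝ (Fin d))) : Prop :=
  ∀ ε : ℝ, 0 < ε → ε < 1 →
    Tendsto (fun C : ℝ => limsup (fun δ : ℝ =>
      limsup (fun N : ℕ => truncatedEnergy μ ε C δ N) atTop) (𝓝[>] 0)) atTop (𝓝 0)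

/-- All the assumptions on the reference measure `μ` with density `ω(x) = ∏ⱼ ωⱼ(xⱼ)` in the
central limit theorem for the determinantal Monte Carlo estimator. -/
structure CLTAssumptions [NeZero d] (ω : Fin d → ℝ → ℝ)
    (μ : Measure (EuclideanSpace ℝ (Fin d))) : Prop where
  density_measurable : ∀ j, Measurable (ω j)
  density_nonneg : ∀ j t, 0 ≤ ω j t
  eq_withDensity : μ = volume.withDensity fun x => ENNReal.ofReal (∏ j, ω j (x j))
  finite : IsFiniteMeasure μ
  supported : μ (cube d 0)ᶜ = 0
  /-- The multivariate orthonormal polynomials of `μ` are well defined. -/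
  nondegenerate : ∀ P : MvPolynomial (Fin d) ℝ, P ≠ 0 →
    Integrable (fun x => polyEval P x ^ 2) μ ∧ 0 < ∫ x, polyEval P x ^ 2 ∂μ
  density_contDiffOn : ContDiffOn ℝ 1 (fun x : EuclideanSpace ℝ (Fin d) => ∏ j, ω j (x j))
    (openCube d)
  density_pos : ∀ x ∈ openCube d, 0 < ∏ j, ω j (x j)
  regular : RegularityAssumption μ

/-! ### Jacobi measures -/

/-- The weight `(1 - t)ᵅ (1 + t)ᵝ 1_{[-1,1]}(t)`. -/
def jacobiWeight (α β t : ℝ) : ℝ :=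
  (Set.Icc (-1 : ℝ) 1).indicator (fun s => (1 - s) ^ α * (1 + s) ^ β) t

/-- The product Jacobi measure `∏ⱼ (1 - xⱼ)^{αⱼ} (1 + xⱼ)^{βⱼ} 1_{[-1,1]}(xⱼ) dxⱼ`. -/
def jacobiMeasure (α β : Fin d → ℝ) : Measure (EuclideanSpace ℝ (Fin d)) :=
  volume.withDensity fun x => ENNReal.ofReal (∏ j, jacobiWeight (α j) (β j) (x j))

end JacobiOPE

end

/-!
The density and moment properties of the product Jacobi measure are elementary; the substance is
the regularity assumption. It holds because the functions `N / K_N(x, x)` are Lipschitz continuous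
on `[-1 + ε, 1 - ε]ᵈ` with a constant independent of `N` (`exists_abs_rateOfChange_le`), so that the
indicator of `|𝒟_N| > C` vanishes on the domain of integration as soon as `C` is large.

In one variable this amounts to three estimates inside the interval, uniform in `n`: the orthonormal
polynomials `p_n` are bounded, `K_n = ∑_{k < n} p_k²` is at least of order `n`, and the derivative
of `K_n` is `O(n)` (`exists_jacobiKernel_bounds`). No asymptotic formula is needed; everything comes
from the differential equation `(1 - x²) p_n'' + q p_n' = -λ_n p_n`, where
`q = β - α - (α + β + 2) x` and `λ_n = n (n + α + β + 1)`, and from the Pearson equation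
`((1 - x²) w)' = q w` of the weight in integrated form.

* The energy `E_n = λ_n p_n² + (1 - x²) p_n'²` satisfies `|E_n'| ≤ B E_n` inside the interval, so
  its values there are comparable. Its integral is `2 λ_n`, whence `p_n = O(1)` and `p_n' = O(n)`.
* The differential equation and the confluent Christoffel-Darboux formula give
  `(1 - x²) K_n' = -q K_n - a_n (λ_n - λ_{n-1}) p_n p_{n-1}` with `|a_n| ≤ 1`, whence `K_n' = O(n)`.
* A virial identity bounds `∫ (1 - x²) p_n² w` below by `1 / 2 - O(1 / λ_n)`. So the mass of
  `p_n² w` does not escape to the ends of the interval, and `E_n ≥ c λ_n` inside it for large `n`.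
  The two halves of `∑_{k < n} E_k` differ by `O(n²)` only, as the Jacobi operator applied to `K_n`
  shows; therefore `∑_{k < n} λ_k p_k²` is of order `n³`, and `K_n` at least of order `n`.

In several variables, an index that is componentwise below another one does not come after it in
the graded order. Hence the Gram-Schmidt algorithm yields the products of the one-dimensional
polynomials (`orthogonalPoly_jacobiMeasure`), and the first `N` indices form a lower set `S` with
`[0, m)ᵈ ⊆ S ⊆ [0, M]ᵈ` and `M + 1 ≤ 2 m`. The inclusions give `K_N(x, x) ≥ c (M + 1)ᵈ`. A line
parallel to a coordinate axis meets `S` in an initial segment, so the one-dimensional bounds give an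
increment of at most `C (M + 1)ᵈ |t|` when one coordinate is moved by `t`.
-/

noncomputable section

namespace JacobiOPE

section OneVariable

open Polynomial

/-! ### The Jacobi weight on the line -/

lemma jacobiWeight_of_mem {α β t : ℝ} (ht : t ∈ Set.Icc (-1 : ℝ) 1) :
    jacobiWeight α β t = (1 - t) ^ α * (1 + t) ^ β := by
  simp only [jacobiWeight, Set.indicator_of_mem ht]

lemma jacobiWeight_of_notMem {α β t : ℝ} (ht : t ∉ Set.Icc (-1 : ℝ) 1) :
    jacobiWeight α β t = 0 := by
  simp only [jacobiWeight, Set.indicator_of_notMem ht]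

lemma jacobiWeight_nonneg (α β t : ℝ) : 0 ≤ jacobiWeight α β t := by
  by_cases ht : t ∈ Set.Icc (-1 : ℝ) 1
  · rw [jacobiWeight_of_mem ht]
    exact mul_nonneg (Real.rpow_nonneg (by linarith [ht.2]) _)
      (Real.rpow_nonneg (by linarith [ht.1]) _)
  · rw [jacobiWeight_of_notMem ht]

lemma jacobiWeight_pos {α β t : ℝ} (ht : t ∈ Set.Ioo (-1 : ℝ) 1) : 0 < jacobiWeight α β t := by
  rw [jacobiWeight_of_mem (Set.Ioo_subset_Icc_self ht)]
  exact mul_pos (Real.rpow_pos_of_pos (by linarith [ht.2]) _)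
    (Real.rpow_pos_of_pos (by linarith [ht.1]) _)

lemma measurable_jacobiWeight (α β : ℝ) : Measurable (jacobiWeight α β) := by
  have h : Measurable fun s : ℝ => (1 - s) ^ α * (1 + s) ^ β := by fun_prop
  exact h.indicator measurableSet_Icc

lemma intervalIntegrable_jacobi {α β : ℝ} (hα : -1 < α) (hβ : -1 < β) :
    IntervalIntegrable (fun s : ℝ => (1 - s) ^ α * (1 + s) ^ β) volume (-1) 1 := by
  have hl : IntervalIntegrable (fun s : ℝ => (1 - s) ^ α * (1 + s) ^ β) volume (-1) 0 := by
    have h1 : IntervalIntegrable (fun s : ℝ => (1 + s) ^ β) volume (-1) 0 := by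
      have := (intervalIntegral.intervalIntegrable_rpow' (a := 0) (b := 1) hβ).comp_add_left 1
      simpa using this
    refine h1.continuousOn_mul ?_
    rw [Set.uIcc_of_le (by norm_num)]
    intro s hs
    refine ContinuousAt.continuousWithinAt (ContinuousAt.rpow_const (by fun_prop) (Or.inl ?_))
    linarith [hs.2]
  have hr : IntervalIntegrable (fun s : ℝ => (1 - s) ^ α * (1 + s) ^ β) volume 0 1 := by
    have h1 : IntervalIntegrable (fun s : ℝ => (1 - s) ^ α) volume 0 1 := by
      have := (intervalIntegral.intervalIntegrable_rpow' (a := 1) (b := 0) hα).comp_sub_left 1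
      simpa using this
    refine h1.mul_continuousOn ?_
    rw [Set.uIcc_of_le (by norm_num)]
    intro s hs
    refine ContinuousAt.continuousWithinAt (ContinuousAt.rpow_const (by fun_prop) (Or.inl ?_))
    linarith [hs.1]
  exact hl.trans hr

lemma integrable_jacobiWeight {α β : ℝ} (hα : -1 < α) (hβ : -1 < β) :
    Integrable (jacobiWeight α β) := by
  have h := (intervalIntegrable_iff_integrableOn_Icc_of_le (by norm_num)).1
    (intervalIntegrable_jacobi hα hβ)
  exact (integrable_indicator_iff measurableSet_Icc).2 h

lemma mul_jacobiWeight_eq_indicator (α β : ℝ) (f : ℝ → ℝ) :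
    (fun t => f t * jacobiWeight α β t) =
      (Set.Icc (-1 : ℝ) 1).indicator (fun s => f s * ((1 - s) ^ α * (1 + s) ^ β)) := by
  ext t
  by_cases ht : t ∈ Set.Icc (-1 : ℝ) 1
  · rw [jacobiWeight_of_mem ht, Set.indicator_of_mem ht]
  · rw [jacobiWeight_of_notMem ht, Set.indicator_of_notMem ht, mul_zero]

lemma integrable_mul_jacobiWeight {α β : ℝ} (hα : -1 < α) (hβ : -1 < β) {f : ℝ → ℝ}
    (hf : Continuous f) : Integrable fun t => f t * jacobiWeight α β t := by
  have h : IntervalIntegrable (fun s => f s * ((1 - s) ^ α * (1 + s) ^ β)) volume (-1) 1 :=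
    (intervalIntegrable_jacobi hα hβ).continuousOn_mul hf.continuousOn
  rw [mul_jacobiWeight_eq_indicator, integrable_indicator_iff measurableSet_Icc]
  exact (intervalIntegrable_iff_integrableOn_Icc_of_le (by norm_num)).1 h

lemma integral_mul_jacobiWeight (α β : ℝ) (f : ℝ → ℝ) :
    ∫ t, f t * jacobiWeight α β t =
      ∫ t in (-1 : ℝ)..1, f t * ((1 - t) ^ α * (1 + t) ^ β) := by
  rw [mul_jacobiWeight_eq_indicator, integral_indicator measurableSet_Icc,
    intervalIntegral.integral_of_le (by norm_num), integral_Icc_eq_integral_Ioc]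

/-- Integration of polynomials against the Jacobi weight, as a linear functional. The two
hypotheses on the exponents make the weight integrable. -/
def jacobiFunctional {α β : ℝ} (hα : -1 < α) (hβ : -1 < β) : ℝ[X] →ₗ[ℝ] ℝ where
  toFun P := ∫ t, P.eval t * jacobiWeight α β t
  map_add' P Q := by
    simp only [eval_add, add_mul]
    exact integral_add (integrable_mul_jacobiWeight hα hβ P.continuous)
      (integrable_mul_jacobiWeight hα hβ Q.continuous)
  map_smul' c P := by
    simp only [eval_smul, smul_eq_mul, mul_assoc, RingHom.id_apply]
    exact integral_const_mul _ _

section functional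

variable {α β : ℝ} (hα : -1 < α) (hβ : -1 < β)

lemma jacobiFunctional_apply (P : ℝ[X]) :
    jacobiFunctional hα hβ P = ∫ t, P.eval t * jacobiWeight α β t := rfl

lemma jacobiFunctional_mono {P Q : ℝ[X]} (h : ∀ t ∈ Set.Icc (-1 : ℝ) 1, P.eval t ≤ Q.eval t) :
    jacobiFunctional hα hβ P ≤ jacobiFunctional hα hβ Q := by
  refine integral_mono (integrable_mul_jacobiWeight hα hβ P.continuous)
    (integrable_mul_jacobiWeight hα hβ Q.continuous) fun t => ?_
  by_cases ht : t ∈ Set.Icc (-1 : ℝ) 1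
  · exact mul_le_mul_of_nonneg_right (h t ht) (jacobiWeight_nonneg _ _ _)
  · simp [jacobiWeight_of_notMem ht]

lemma jacobiFunctional_sq_pos {P : ℝ[X]} (hP : P ≠ 0) : 0 < jacobiFunctional hα hβ (P * P) := by
  rw [jacobiFunctional_apply, integral_pos_iff_support_of_nonneg
    (fun t => mul_nonneg (by simpa using mul_self_nonneg _) (jacobiWeight_nonneg _ _ _))
    (integrable_mul_jacobiWeight hα hβ (P * P).continuous)]
  have hsub : Set.Ioo (-1 : ℝ) 1 \ P.rootSet ℝ ⊆
      Function.support fun t => (P * P).eval t * jacobiWeight α β t := by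
    rintro t ⟨ht, hr⟩
    have h1 : P.eval t ≠ 0 := fun h => hr (by
      rw [mem_rootSet]; exact ⟨hP, by simpa using h⟩)
    have h2 := (jacobiWeight_pos (α := α) (β := β) ht).ne'
    simp [h1, h2]
  refine lt_of_lt_of_le ?_ (measure_mono hsub)
  rw [measure_sdiff_null ((P.rootSet_finite ℝ).measure_zero _)]
  simp

/-- The Pearson equation `((1 - t²) w)' = (β - α - (α + β + 2) t) w` in integrated form: the
functions `(1 - t²) w P` vanish at both ends of the interval, so their derivatives have
integral zero. -/
lemma jacobiFunctional_pearson (P : ℝ[X]) :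
    jacobiFunctional hα hβ
      ((1 - X ^ 2) * derivative P + (C (β - α) - C (α + β + 2) * X) * P) = 0 := by
  rw [jacobiFunctional_apply, integral_mul_jacobiWeight]
  have key := intervalIntegral.integral_eq_sub_of_hasDerivAt_of_le (a := -1) (b := 1)
    (f := fun t : ℝ => P.eval t * ((1 - t) ^ (α + 1) * (1 + t) ^ (β + 1)))
    (f' := fun t : ℝ => ((1 - X ^ 2) * derivative P +
      (C (β - α) - C (α + β + 2) * X) * P).eval t * ((1 - t) ^ α * (1 + t) ^ β))
    (by norm_num) ?_ ?_ ?_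
  · rw [key]
    simp [Real.zero_rpow (by linarith : α + 1 ≠ 0), Real.zero_rpow (by linarith : β + 1 ≠ 0)]
  · refine P.continuous.continuousOn.mul (ContinuousOn.mul ?_ ?_)
    · exact ContinuousOn.rpow_const (by fun_prop) fun t _ => Or.inr (by linarith)
    · exact ContinuousOn.rpow_const (by fun_prop) fun t _ => Or.inr (by linarith)
  · intro t ht
    have h1 : (0 : ℝ) < 1 - t := by linarith [ht.2]
    have h2 : (0 : ℝ) < 1 + t := by linarith [ht.1]
    have d1 : HasDerivAt (fun t : ℝ => (1 - t) ^ (α + 1)) (-1 * (α + 1) * (1 - t) ^ α) t := by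
      have := ((hasDerivAt_id t).const_sub 1).rpow_const (p := α + 1) (Or.inl h1.ne')
      simpa using this
    have d2 : HasDerivAt (fun t : ℝ => (1 + t) ^ (β + 1)) (1 * (β + 1) * (1 + t) ^ β) t := by
      have := ((hasDerivAt_id t).const_add 1).rpow_const (p := β + 1) (Or.inl h2.ne')
      simpa using this
    refine ((P.hasDerivAt t).mul (d1.mul d2)).congr_deriv ?_
    simp only [Pi.mul_apply, Real.rpow_add_one h1.ne', Real.rpow_add_one h2.ne',
      eval_add, eval_sub, eval_mul, eval_pow, eval_one, eval_X, eval_C]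
    ring
  · exact (intervalIntegrable_jacobi hα hβ).continuousOn_mul (Polynomial.continuous _).continuousOn

end functional

/-! ### Orthogonal polynomials of a positive functional -/

/-- The monic orthogonal polynomials of a linear functional `Λ` on `ℝ[X]`, that is, the
Gram-Schmidt algorithm without normalization for the form `(P, Q) ↦ Λ (P Q)` applied to the
powers of `X`. -/
def monicOrth (Λ : ℝ[X] →ₗ[ℝ] ℝ) (n : ℕ) : ℝ[X] :=
  X ^ n - ∑ k : Fin n,
    (Λ (X ^ n * monicOrth Λ k.1) / Λ (monicOrth Λ k.1 * monicOrth Λ k.1)) • monicOrth Λ k.1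
termination_by n
decreasing_by all_goals exact k.2

/-- The orthonormal polynomials of a linear functional on `ℝ[X]`. -/
def orthonormal (Λ : ℝ[X] →ₗ[ℝ] ℝ) (n : ℕ) : ℝ[X] :=
  (√(Λ (monicOrth Λ n * monicOrth Λ n)))⁻¹ • monicOrth Λ n

section Orthogonal

variable (Λ : ℝ[X] →ₗ[ℝ] ℝ)

/-- The coefficients of the powers of `X` in the basis of monic orthogonal polynomials; the
junk values for `k > n` play no role. -/
def powCoeff (n k : ℕ) : ℝ :=
  if k = n then 1 else Λ (X ^ n * monicOrth Λ k) / Λ (monicOrth Λ k * monicOrth Λ k)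

@[simp] lemma powCoeff_self (n : ℕ) : powCoeff Λ n n = 1 := if_pos rfl

lemma X_pow_eq_sum_monicOrth (n : ℕ) :
    (X : ℝ[X]) ^ n = ∑ k ∈ Finset.range (n + 1), powCoeff Λ n k • monicOrth Λ k := by
  have h : ∑ k ∈ Finset.range n, powCoeff Λ n k • monicOrth Λ k = ∑ k : Fin n,
      (Λ (X ^ n * monicOrth Λ k.1) / Λ (monicOrth Λ k.1 * monicOrth Λ k.1)) •
        monicOrth Λ k.1 := by
    rw [← Fin.sum_univ_eq_sum_range (fun k => powCoeff Λ n k • monicOrth Λ k)]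
    exact Finset.sum_congr rfl fun k _ => by rw [powCoeff, if_neg k.2.ne]
  rw [Finset.sum_range_succ, h, powCoeff_self, one_smul]
  conv_rhs => rw [monicOrth]
  abel

lemma degree_monicOrth_sub_lt (n : ℕ) : (monicOrth Λ n - X ^ n).degree < (n : WithBot ℕ) := by
  induction n using Nat.strong_induction_on with
  | _ n ih =>
  rw [monicOrth, sub_sub_cancel_left, degree_neg]
  refine (degree_sum_le _ _).trans_lt ((Finset.sup_lt_iff (WithBot.bot_lt_coe n)).2 fun k _ => ?_)
  have h1 : (monicOrth Λ k.1).degree ≤ k.1 := by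
    have := degree_add_le (monicOrth Λ k.1 - X ^ k.1) (X ^ k.1)
    rw [sub_add_cancel] at this
    exact this.trans (max_le (ih k.1 k.2).le (degree_X_pow_le _))
  exact ((degree_smul_le _ _).trans h1).trans_lt (WithBot.coe_lt_coe.2 k.2)

lemma degree_monicOrth (n : ℕ) : (monicOrth Λ n).degree = n := by
  have h := degree_add_eq_right_of_degree_lt (p := monicOrth Λ n - X ^ n) (q := X ^ n)
    (by simpa using degree_monicOrth_sub_lt Λ n)
  simpa using h

lemma monicOrth_ne_zero (n : ℕ) : monicOrth Λ n ≠ 0 := fun h => by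
  have := degree_monicOrth Λ n
  simp [h] at this

section positive

variable {Λ} (hΛ : ∀ P : ℝ[X], P ≠ 0 → 0 < Λ (P * P))
include hΛ

lemma monicOrth_sq_pos (n : ℕ) : 0 < Λ (monicOrth Λ n * monicOrth Λ n) :=
  hΛ _ (monicOrth_ne_zero Λ n)

lemma monicOrth_orthogonal_of_lt (n : ℕ) : ∀ k < n, Λ (monicOrth Λ n * monicOrth Λ k) = 0 := by
  induction n using Nat.strong_induction_on with
  | _ n ih =>
  intro k hk
  rw [monicOrth, sub_mul, Finset.sum_mul, map_sub, map_sum, Finset.sum_eq_single ⟨k, hk⟩]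
  · rw [smul_mul_assoc, map_smul, smul_eq_mul, div_mul_cancel₀ _ (monicOrth_sq_pos hΛ k).ne',
      sub_self]
  · intro l _ hl
    have hl' : l.1 ≠ k := fun h => hl (Fin.ext h)
    rw [smul_mul_assoc, map_smul]
    rcases lt_or_gt_of_ne hl' with h | h
    · rw [mul_comm (monicOrth Λ l.1) (monicOrth Λ k), ih k hk l.1 h, smul_zero]
    · rw [ih l.1 l.2 k h, smul_zero]
  · simp

lemma monicOrth_orthogonal {m n : ℕ} (h : m ≠ n) : Λ (monicOrth Λ m * monicOrth Λ n) = 0 := by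
  rcases lt_or_gt_of_ne h with h | h
  · rw [mul_comm, monicOrth_orthogonal_of_lt hΛ n m h]
  · exact monicOrth_orthogonal_of_lt hΛ m n h

lemma orthonormal_self (n : ℕ) : Λ (orthonormal Λ n * orthonormal Λ n) = 1 := by
  have h := monicOrth_sq_pos hΛ n
  rw [orthonormal, smul_mul_smul_comm, map_smul, smul_eq_mul, ← mul_inv,
    Real.mul_self_sqrt h.le, inv_mul_cancel₀ h.ne']

lemma orthonormal_of_ne {m n : ℕ} (h : m ≠ n) : Λ (orthonormal Λ m * orthonormal Λ n) = 0 := by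
  rw [orthonormal, orthonormal, smul_mul_smul_comm, map_smul, monicOrth_orthogonal hΛ h, smul_zero]

lemma degree_orthonormal (n : ℕ) : (orthonormal Λ n).degree = n := by
  rw [orthonormal, degree_smul_of_smul_regular, degree_monicOrth]
  have h : (√(Λ (monicOrth Λ n * monicOrth Λ n)))⁻¹ ≠ 0 :=
    inv_ne_zero (Real.sqrt_pos.2 (monicOrth_sq_pos hΛ n)).ne'
  exact IsSMulRegular.of_ne_zero h

lemma natDegree_orthonormal (n : ℕ) : (orthonormal Λ n).natDegree = n :=
  natDegree_eq_of_degree_eq_some (degree_orthonormal hΛ n)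

/-- A polynomial of degree less than `n` is its own Fourier sum of order `n`. -/
lemma eq_sum_orthonormal {n : ℕ} {Q : ℝ[X]} (hQ : Q.degree < n) :
    Q = ∑ k ∈ Finset.range n, Λ (Q * orthonormal Λ k) • orthonormal Λ k := by
  have key : ∃ c : ℕ → ℝ, Q = ∑ k ∈ Finset.range n, c k • orthonormal Λ k := by
    induction n generalizing Q with
    | zero =>
      refine ⟨0, ?_⟩
      rw [Nat.cast_zero, Nat.WithBot.lt_zero_iff, degree_eq_bot] at hQ
      simpa using hQ
    | succ n ih =>
      have hne : (orthonormal Λ n).coeff n ≠ 0 := by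
        have h := degree_orthonormal hΛ n
        exact coeff_ne_zero_of_eq_degree h
      set r := Q.coeff n / (orthonormal Λ n).coeff n with hr
      have hdeg : (Q - r • orthonormal Λ n).degree < n := by
        rw [degree_lt_iff_coeff_zero]
        intro m hm
        rcases hm.eq_or_lt with rfl | hm
        · simp [hr, hne]
        · have h1 : Q.coeff m = 0 := coeff_eq_zero_of_degree_lt
            (hQ.trans_le (by exact_mod_cast hm))
          have h2 : (orthonormal Λ n).coeff m = 0 := coeff_eq_zero_of_degree_lt
            (by rw [degree_orthonormal hΛ]; exact_mod_cast hm)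
          simp [h1, h2]
      obtain ⟨c, hc⟩ := ih hdeg
      refine ⟨Function.update c n r, ?_⟩
      rw [Finset.sum_range_succ, Function.update_self, eq_add_of_sub_eq hc]
      congr 1
      exact Finset.sum_congr rfl fun k hk => by
        rw [Function.update_of_ne (Finset.mem_range.1 hk).ne]
  obtain ⟨c, hc⟩ := key
  conv_lhs => rw [hc]
  refine Finset.sum_congr rfl fun k hk => ?_
  congr 1
  rw [hc, Finset.sum_mul, map_sum, Finset.sum_eq_single k]
  · rw [smul_mul_assoc, map_smul, orthonormal_self hΛ, smul_eq_mul, mul_one]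
  · intro l _ hl
    rw [smul_mul_assoc, map_smul, orthonormal_of_ne hΛ hl, smul_zero]
  · exact fun h => absurd hk h

lemma orthonormal_orthogonal {n : ℕ} {Q : ℝ[X]} (hQ : Q.degree < n) :
    Λ (Q * orthonormal Λ n) = 0 := by
  rw [eq_sum_orthonormal hΛ hQ, Finset.sum_mul, map_sum]
  refine Finset.sum_eq_zero fun k hk => ?_
  rw [smul_mul_assoc, map_smul, orthonormal_of_ne hΛ (Finset.mem_range.1 hk).ne, smul_zero]

lemma three_term_zero : X * orthonormal Λ 0 =
    Λ (X * orthonormal Λ 0 * orthonormal Λ 1) • orthonormal Λ 1 +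
      Λ (X * orthonormal Λ 0 * orthonormal Λ 0) • orthonormal Λ 0 := by
  have h := eq_sum_orthonormal hΛ (n := 2) (Q := X * orthonormal Λ 0)
    (by rw [degree_mul, degree_orthonormal hΛ, degree_X]; norm_num)
  rw [Finset.sum_range_succ, Finset.sum_range_one] at h
  rw [add_comm]
  exact h

/-- The three-term recurrence. -/
lemma three_term (n : ℕ) : X * orthonormal Λ (n + 1) =
    Λ (X * orthonormal Λ (n + 1) * orthonormal Λ (n + 2)) • orthonormal Λ (n + 2) +
      Λ (X * orthonormal Λ (n + 1) * orthonormal Λ (n + 1)) • orthonormal Λ (n + 1) +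
      Λ (X * orthonormal Λ n * orthonormal Λ (n + 1)) • orthonormal Λ n := by
  have h := eq_sum_orthonormal hΛ (n := n + 3) (Q := X * orthonormal Λ (n + 1)) (by
    rw [degree_mul, degree_orthonormal hΛ, degree_X]
    norm_cast
    omega)
  rw [Finset.sum_range_succ, Finset.sum_range_succ, Finset.sum_range_succ,
    Finset.sum_eq_zero, zero_add, mul_right_comm X _ (orthonormal Λ n)] at h
  · conv_lhs => rw [h]
    abel
  · intro k hk
    have hd : (X * orthonormal Λ k).degree < ((n + 1 : ℕ) : WithBot ℕ) := by
      rw [degree_mul, degree_orthonormal hΛ, degree_X]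
      have := Finset.mem_range.1 hk
      norm_cast
      omega
    rw [mul_right_comm, orthonormal_orthogonal hΛ hd, zero_smul]

/-- The confluent Christoffel-Darboux formula
`∑_{k ≤ n} p_k² = a_{n+1} (p_{n+1}' p_n - p_{n+1} p_n')`. -/
lemma christoffel_darboux (n : ℕ) :
    ∑ k ∈ Finset.range (n + 1), orthonormal Λ k ^ 2 =
      Λ (X * orthonormal Λ n * orthonormal Λ (n + 1)) •
        (derivative (orthonormal Λ (n + 1)) * orthonormal Λ n -
          orthonormal Λ (n + 1) * derivative (orthonormal Λ n)) := by
  induction n with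
  | zero =>
    have h := three_term_zero hΛ
    have h' := congrArg derivative h
    simp only [derivative_mul, derivative_X, derivative_add, derivative_smul, one_mul] at h'
    rw [zero_add, Finset.sum_range_one]
    simp only [smul_eq_C_mul] at h h' ⊢
    linear_combination orthonormal Λ 0 * h' - derivative (orthonormal Λ 0) * h
  | succ n ih =>
    have h := three_term hΛ n
    have h' := congrArg derivative h
    simp only [derivative_mul, derivative_X, derivative_add, derivative_smul, one_mul] at h'
    rw [Finset.sum_range_succ, ih]
    simp only [smul_eq_C_mul] at h h' ⊢
    linear_combination orthonormal Λ (n + 1) * h' - derivative (orthonormal Λ (n + 1)) * h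

end positive

end Orthogonal

/-! ### The differential equation of the Jacobi polynomials -/

/-- The orthonormal Jacobi polynomials. -/
def jacobiPoly {α β : ℝ} (hα : -1 < α) (hβ : -1 < β) (n : ℕ) : ℝ[X] :=
  orthonormal (jacobiFunctional hα hβ) n

/-- The polynomial `(β - α) - (α + β + 2) X`, the first order coefficient of the Jacobi
differential operator `P ↦ (1 - X²) P'' + q P'`. -/
def jacobiDrift (α β : ℝ) : ℝ[X] := C (β - α) - C (α + β + 2) * X

/-- The eigenvalue `n (n + α + β + 1)` of the Jacobi differential operator, up to sign. -/
def jacobiEigenvalue (α β : ℝ) (n : ℕ) : ℝ := n * (n + α + β + 1)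

lemma derivative_jacobiDrift (α β : ℝ) : derivative (jacobiDrift α β) = -C (α + β + 2) := by
  simp [jacobiDrift]

lemma eval_jacobiDrift (α β x : ℝ) : (jacobiDrift α β).eval x = (β - α) - (α + β + 2) * x := by
  simp [jacobiDrift]

section

variable {α β : ℝ} (hα : -1 < α) (hβ : -1 < β)

lemma natDegree_jacobiPoly (n : ℕ) : (jacobiPoly hα hβ n).natDegree = n :=
  natDegree_orthonormal (fun _ => jacobiFunctional_sq_pos hα hβ) n

lemma jacobiFunctional_jacobiPoly_sq (n : ℕ) :
    jacobiFunctional hα hβ (jacobiPoly hα hβ n ^ 2) = 1 := by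
  rw [sq]
  exact orthonormal_self (fun _ => jacobiFunctional_sq_pos hα hβ) n

lemma jacobiFunctional_operator_mul (P Q : ℝ[X]) :
    jacobiFunctional hα hβ (((1 - X ^ 2) * derivative (derivative P) +
      jacobiDrift α β * derivative P) * Q) =
      -jacobiFunctional hα hβ ((1 - X ^ 2) * derivative P * derivative Q) := by
  have h := jacobiFunctional_pearson hα hβ (derivative P * Q)
  rw [← sub_eq_zero, sub_neg_eq_add, ← map_add, ← h, derivative_mul, jacobiDrift]
  congr 1
  ring

lemma coeff_operator {P : ℝ[X]} {n : ℕ} (hP : P.natDegree ≤ n) (m : ℕ) (hm : n ≤ m) :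
    ((1 - X ^ 2) * derivative (derivative P) + jacobiDrift α β * derivative P).coeff m =
      -jacobiEigenvalue α β m * P.coeff m := by
  have h1 : P.coeff (m + 1) = 0 := coeff_eq_zero_of_natDegree_lt (by omega)
  have h2 : P.coeff (m + 2) = 0 := coeff_eq_zero_of_natDegree_lt (by omega)
  have e1 : (X * derivative P).coeff m = m * P.coeff m := by
    rcases m with _ | m
    · simp
    · rw [coeff_X_mul, coeff_derivative]
      push_cast
      ring
  have e2 : (X ^ 2 * derivative (derivative P)).coeff m = m * (m - 1) * P.coeff m := by
    rcases m with _ | _ | m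
    · simp
    · simp [coeff_X_pow_mul']
    · rw [coeff_X_pow_mul, coeff_derivative, coeff_derivative]
      push_cast
      ring
  simp only [jacobiDrift, jacobiEigenvalue, sub_mul, mul_assoc, one_mul, coeff_add, coeff_sub,
    coeff_C_mul, coeff_derivative, e1, e2, h1, h2]
  ring

/-- The differential equation of the Jacobi polynomials. -/
lemma jacobiPoly_ode (n : ℕ) :
    (1 - X ^ 2) * derivative (derivative (jacobiPoly hα hβ n)) +
      jacobiDrift α β * derivative (jacobiPoly hα hβ n) =
      -C (jacobiEigenvalue α β n) * jacobiPoly hα hβ n := by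
  set p := jacobiPoly hα hβ n with hp
  set R := (1 - X ^ 2) * derivative (derivative p) + jacobiDrift α β * derivative p +
    C (jacobiEigenvalue α β n) * p with hR
  have hn : p.natDegree ≤ n := (natDegree_jacobiPoly hα hβ n).le
  suffices R = 0 by
    rw [neg_mul]
    exact eq_neg_of_add_eq_zero_left this
  have hdeg : R.degree < (n : WithBot ℕ) := by
    rw [degree_lt_iff_coeff_zero]
    intro m hm
    rw [hR, coeff_add, coeff_operator hn m hm, coeff_C_mul]
    rcases hm.eq_or_lt with rfl | hm
    · ring
    · rw [coeff_eq_zero_of_natDegree_lt (hn.trans_lt hm)]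
      ring
  -- The operator is symmetric and does not raise degrees, so `R` is orthogonal to itself.
  have horth : jacobiFunctional hα hβ (R * R) = 0 := by
    have hop : ((1 - X ^ 2) * derivative (derivative R) +
        jacobiDrift α β * derivative R).degree < (n : WithBot ℕ) := by
      rw [degree_lt_iff_coeff_zero]
      intro m hm
      have hRn : R.natDegree ≤ n := natDegree_le_of_degree_le hdeg.le
      rw [coeff_operator hRn m hm, coeff_eq_zero_of_degree_lt
        (hdeg.trans_le (by exact_mod_cast hm)), mul_zero]
    have h1 := orthonormal_orthogonal (fun _ => jacobiFunctional_sq_pos hα hβ) hop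
    have h2 := orthonormal_orthogonal (fun _ => jacobiFunctional_sq_pos hα hβ) hdeg
    have h3 := jacobiFunctional_operator_mul hα hβ p R
    have h4 := jacobiFunctional_operator_mul hα hβ R p
    change jacobiFunctional hα hβ (_ * p) = 0 at h1 h2
    have hRR : R * R = ((1 - X ^ 2) * derivative (derivative p) +
        jacobiDrift α β * derivative p) * R + C (jacobiEigenvalue α β n) * (R * p) := by
      linear_combination R * hR
    rw [hRR, map_add, h3, ← smul_eq_C_mul, map_smul, h2, smul_zero, add_zero, mul_right_comm,
      ← h4, h1]
  by_contra h
  exact (jacobiFunctional_sq_pos hα hβ h).ne' horth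

lemma jacobiFunctional_deriv_sq (n : ℕ) :
    jacobiFunctional hα hβ ((1 - X ^ 2) * derivative (jacobiPoly hα hβ n) ^ 2) =
      jacobiEigenvalue α β n := by
  have h := jacobiFunctional_operator_mul hα hβ (jacobiPoly hα hβ n) (jacobiPoly hα hβ n)
  rw [jacobiPoly_ode, ← C_neg, mul_assoc, ← smul_eq_C_mul, map_smul, ← sq,
    jacobiFunctional_jacobiPoly_sq, smul_eq_mul, mul_one, neg_inj] at h
  rw [h, sq (derivative _), mul_assoc]

/-- The recurrence coefficient `∫ t p_n(t) p_{n+1}(t) w(t) dt`. -/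
def jacobiRecurrence (n : ℕ) : ℝ :=
  jacobiFunctional hα hβ (X * jacobiPoly hα hβ n * jacobiPoly hα hβ (n + 1))

lemma abs_jacobiRecurrence_le (n : ℕ) : |jacobiRecurrence hα hβ n| ≤ 1 := by
  have hsq : jacobiFunctional hα hβ ((1 / 2 : ℝ) •
      (jacobiPoly hα hβ n ^ 2 + jacobiPoly hα hβ (n + 1) ^ 2)) = 1 := by
    rw [map_smul, map_add, jacobiFunctional_jacobiPoly_sq, jacobiFunctional_jacobiPoly_sq]
    norm_num
  rw [abs_le]
  constructor
  · rw [← hsq, jacobiRecurrence, ← map_neg]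
    refine jacobiFunctional_mono hα hβ fun t ht => ?_
    simp only [eval_neg, eval_smul, eval_add, eval_pow, eval_mul, eval_X, smul_eq_mul]
    nlinarith [mul_nonneg (by linarith [ht.1] : 0 ≤ 1 + t)
      (sq_nonneg ((jacobiPoly hα hβ n).eval t + (jacobiPoly hα hβ (n + 1)).eval t)),
      mul_nonneg (by linarith [ht.2] : 0 ≤ 1 - t)
      (sq_nonneg ((jacobiPoly hα hβ n).eval t - (jacobiPoly hα hβ (n + 1)).eval t))]
  · rw [← hsq, jacobiRecurrence]
    refine jacobiFunctional_mono hα hβ fun t ht => ?_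
    simp only [eval_smul, eval_add, eval_pow, eval_mul, eval_X, smul_eq_mul]
    nlinarith [mul_nonneg (by linarith [ht.2] : 0 ≤ 1 - t)
      (sq_nonneg ((jacobiPoly hα hβ n).eval t + (jacobiPoly hα hβ (n + 1)).eval t)),
      mul_nonneg (by linarith [ht.1] : 0 ≤ 1 + t)
      (sq_nonneg ((jacobiPoly hα hβ n).eval t - (jacobiPoly hα hβ (n + 1)).eval t))]

/-- The diagonal `∑_{k < n} p_k²` of the one-dimensional Christoffel-Darboux kernel, as a
polynomial. -/
def jacobiKernel (n : ℕ) : ℝ[X] := ∑ k ∈ Finset.range n, jacobiPoly hα hβ k ^ 2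

/-- The differential equations for `p_n` and `p_{n+1}` turn the Christoffel-Darboux formula into
an equation for the derivative of the kernel, in which only first powers of `n` appear. -/
lemma deriv_jacobiKernel (n : ℕ) :
    (1 - X ^ 2) * derivative (jacobiKernel hα hβ (n + 1)) =
      -jacobiDrift α β * jacobiKernel hα hβ (n + 1) -
        C (jacobiRecurrence hα hβ n * (2 * n + α + β + 2)) *
          (jacobiPoly hα hβ n * jacobiPoly hα hβ (n + 1)) := by
  have hcd : jacobiKernel hα hβ (n + 1) = jacobiRecurrence hα hβ n •
      (derivative (jacobiPoly hα hβ (n + 1)) * jacobiPoly hα hβ n -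
        jacobiPoly hα hβ (n + 1) * derivative (jacobiPoly hα hβ n)) :=
    christoffel_darboux (fun _ => jacobiFunctional_sq_pos hα hβ) n
  have hC : (C (jacobiRecurrence hα hβ n * (2 * n + α + β + 2)) : ℝ[X]) =
      C (jacobiRecurrence hα hβ n) *
        (C (jacobiEigenvalue α β (n + 1)) - C (jacobiEigenvalue α β n)) := by
    rw [← C_sub, ← C_mul, jacobiEigenvalue, jacobiEigenvalue]
    congr 1
    push_cast
    ring
  rw [hcd, hC]
  simp only [smul_eq_C_mul, derivative_mul, derivative_C, derivative_sub]
  linear_combination C (jacobiRecurrence hα hβ n) *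
    (jacobiPoly hα hβ n * jacobiPoly_ode hα hβ (n + 1) -
      jacobiPoly hα hβ (n + 1) * jacobiPoly_ode hα hβ n)

/-- The Jacobi differential operator applied to `p_n²`. -/
lemma operator_jacobiPoly_sq (n : ℕ) :
    (1 - X ^ 2) * derivative (derivative (jacobiPoly hα hβ n ^ 2)) +
      jacobiDrift α β * derivative (jacobiPoly hα hβ n ^ 2) =
    2 * ((1 - X ^ 2) * derivative (jacobiPoly hα hβ n) ^ 2) -
      2 * (C (jacobiEigenvalue α β n) * jacobiPoly hα hβ n ^ 2) := by
  have h := jacobiPoly_ode hα hβ n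
  simp only [sq (jacobiPoly hα hβ n), derivative_mul, derivative_add]
  linear_combination 2 * jacobiPoly hα hβ n * h

end

/-! ### The virial identity -/

section

variable {α β : ℝ} (hα : -1 < α) (hβ : -1 < β)

include hα hβ in
lemma mul_pred_le_jacobiEigenvalue (n : ℕ) : (n : ℝ) * (n - 1) ≤ jacobiEigenvalue α β n := by
  rw [jacobiEigenvalue]
  exact mul_le_mul_of_nonneg_left (by linarith) n.cast_nonneg

include hα hβ in
lemma jacobiEigenvalue_le (n : ℕ) :
    jacobiEigenvalue α β n ≤ (α + β + 3) * ((n : ℝ) + 1) ^ 2 := by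
  rw [jacobiEigenvalue]
  have hn : (0 : ℝ) ≤ n := n.cast_nonneg
  have hs : 0 ≤ α + β + 2 := by linarith
  nlinarith [mul_nonneg hs hn, mul_nonneg hs (sq_nonneg (n : ℝ))]

include hα hβ in
lemma jacobiEigenvalue_pos {n : ℕ} (hn : n ≠ 0) : 0 < jacobiEigenvalue α β n := by
  have hn' : (1 : ℝ) ≤ n := by exact_mod_cast Nat.one_le_iff_ne_zero.2 hn
  rw [jacobiEigenvalue]
  exact mul_pos (by linarith) (by linarith)

/-- The test function of the virial identity: `1 - (β - α) X + (α + β - 1) X²`. -/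
def virialTest (α β : ℝ) : ℝ[X] := 1 - 3 * X ^ 2 - X * jacobiDrift α β

/-- Up to a term that does not grow with `n`, the mean of `2 - 4 t²` with respect to `p_n² w`
vanishes. This is the Pearson equation for a combination of `X (1 - X²) p'²`, `X p²`, `p p'` and
`p²` chosen such that all the terms with `p'` cancel. -/
lemma virial_identity (n : ℕ) :
    jacobiFunctional hα hβ (C (2 * jacobiEigenvalue α β n) * (2 - 4 * X ^ 2) *
        jacobiPoly hα hβ n ^ 2 + ((1 - X ^ 2) * derivative (derivative (virialTest α β)) +
        jacobiDrift α β * derivative (virialTest α β)) * jacobiPoly hα hβ n ^ 2) = 0 := by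
  set p := jacobiPoly hα hβ n with hp
  rw [← jacobiFunctional_pearson hα hβ (2 * (X * (1 - X ^ 2) * derivative p ^ 2) +
    C (2 * jacobiEigenvalue α β n) * (X * p ^ 2) - 2 * (virialTest α β * p * derivative p) +
    derivative (virialTest α β) * p ^ 2)]
  congr 1
  have h := jacobiPoly_ode hα hβ n
  rw [← hp] at h
  have h2 : (C (2 * jacobiEigenvalue α β n) : ℝ[X]) = 2 * C (jacobiEigenvalue α β n) := by
    rw [C_mul]
    rfl
  have h3 : derivative (2 : ℝ[X]) = 0 := derivative_ofNat 2
  have h4 : derivative (3 : ℝ[X]) = 0 := derivative_ofNat 3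
  change _ = (1 - X ^ 2) * _ + jacobiDrift α β * _
  rw [h2]
  simp only [virialTest, sq, derivative_mul, derivative_add, derivative_sub, derivative_X,
    derivative_C, derivative_one, h3, h4, derivative_jacobiDrift, derivative_neg] at h ⊢
  linear_combination (-(2 * (2 * X * (1 - X ^ 2) * derivative p -
    (1 - 3 * X ^ 2 - X * jacobiDrift α β) * p))) * h

/-- The mass of `p_n² w` does not concentrate at the ends of the interval. -/
lemma exists_virial_bound : ∃ G : ℝ, ∀ n : ℕ, 4 * jacobiEigenvalue α β n - G ≤
    8 * jacobiEigenvalue α β n *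
      jacobiFunctional hα hβ ((1 - X ^ 2) * jacobiPoly hα hβ n ^ 2) := by
  set Q := (1 - X ^ 2) * derivative (derivative (virialTest α β)) +
    jacobiDrift α β * derivative (virialTest α β) with hQ
  obtain ⟨G, hG⟩ := isCompact_Icc.exists_bound_of_continuousOn
    (Q.continuous.continuousOn (s := Set.Icc (-1 : ℝ) 1))
  refine ⟨G, fun n => ?_⟩
  set p := jacobiPoly hα hβ n with hp
  have h1 : jacobiFunctional hα hβ (Q * p ^ 2) ≤ G := by
    have : jacobiFunctional hα hβ (Q * p ^ 2) ≤ jacobiFunctional hα hβ (G • p ^ 2) := by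
      refine jacobiFunctional_mono hα hβ fun t ht => ?_
      rw [eval_mul, eval_smul, smul_eq_mul, eval_pow]
      exact mul_le_mul_of_nonneg_right ((le_abs_self _).trans (hG t ht)) (sq_nonneg _)
    rwa [map_smul, hp, jacobiFunctional_jacobiPoly_sq, smul_eq_mul, mul_one] at this
  have h2 := virial_identity hα hβ n
  rw [map_add, ← hQ, ← hp] at h2
  have h3 : C (2 * jacobiEigenvalue α β n) * (2 - 4 * X ^ 2) * p ^ 2 =
      (8 * jacobiEigenvalue α β n) • ((1 - X ^ 2) * p ^ 2) -
        (4 * jacobiEigenvalue α β n) • p ^ 2 := by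
    have e2 : (C (2 : ℝ) : ℝ[X]) = 2 := rfl
    have e4 : (C (4 : ℝ) : ℝ[X]) = 4 := rfl
    have e8 : (C (8 : ℝ) : ℝ[X]) = 8 := rfl
    rw [smul_eq_C_mul, smul_eq_C_mul, C_mul, C_mul, C_mul, e2, e4, e8]
    ring
  rw [h3, map_sub, map_smul, map_smul, smul_eq_mul, smul_eq_mul] at h2
  have h4 := jacobiFunctional_jacobiPoly_sq hα hβ n
  rw [← hp] at h4
  rw [h4] at h2
  linarith

end

/-! ### Energy estimates inside the interval -/

/-- A form of Grönwall's inequality: a function with `|f'| ≤ B f` on an interval has comparable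
values at any two points of it. -/
lemma le_exp_mul_of_abs_deriv_le {f f' : ℝ → ℝ} {a b B : ℝ} (hf : ∀ x, HasDerivAt f (f' x) x)
    (hB : 0 ≤ B) (h0 : ∀ x ∈ Set.Icc a b, 0 ≤ f x)
    (h : ∀ x ∈ Set.Icc a b, |f' x| ≤ B * f x) {x y : ℝ} (hx : x ∈ Set.Icc a b)
    (hy : y ∈ Set.Icc a b) : f x ≤ Real.exp (B * (b - a)) * f y := by
  have hd : ∀ s x : ℝ, HasDerivAt (fun x => f x * Real.exp (s * x))
      ((f' x + s * f x) * Real.exp (s * x)) x := fun s x => by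
    have h1 : HasDerivAt (fun x => Real.exp (s * x)) (Real.exp (s * x) * s) x := by
      simpa using ((hasDerivAt_id x).const_mul s).exp
    exact ((hf x).mul h1).congr_deriv (by ring)
  have hc : ∀ s : ℝ, ContinuousOn (fun x => f x * Real.exp (s * x)) (Set.Icc a b) :=
    fun s x _ => (hd s x).continuousAt.continuousWithinAt
  have hmono : MonotoneOn (fun x => f x * Real.exp (B * x)) (Set.Icc a b) := by
    refine monotoneOn_of_deriv_nonneg (convex_Icc a b) (hc B)
      (fun x _ => (hd B x).differentiableAt.differentiableWithinAt) fun x hx => ?_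
    rw [(hd B x).deriv]
    have := (abs_le.1 (h x (interior_subset hx))).1
    exact mul_nonneg (by linarith) (Real.exp_pos _).le
  have hanti : AntitoneOn (fun x => f x * Real.exp (-B * x)) (Set.Icc a b) := by
    refine antitoneOn_of_deriv_nonpos (convex_Icc a b) (hc (-B))
      (fun x _ => (hd (-B) x).differentiableAt.differentiableWithinAt) fun x hx => ?_
    rw [(hd (-B) x).deriv]
    have := (abs_le.1 (h x (interior_subset hx))).2
    exact mul_nonpos_of_nonpos_of_nonneg (by linarith) (Real.exp_pos _).le
  suffices f x ≤ Real.exp (B * |y - x|) * f y by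
    refine this.trans (mul_le_mul_of_nonneg_right (Real.exp_le_exp.2 ?_) (h0 y hy))
    refine mul_le_mul_of_nonneg_left (abs_le.2 ⟨?_, ?_⟩) hB
    · linarith [hx.2, hy.1]
    · linarith [hx.1, hy.2]
  rcases le_total x y with hxy | hxy
  · have h1 := hmono hx hy hxy
    simp only at h1
    rw [abs_of_nonneg (by linarith), ← mul_le_mul_iff_of_pos_right (Real.exp_pos (B * x))]
    refine h1.trans_eq ?_
    rw [mul_right_comm, ← Real.exp_add, mul_comm]
    ring_nf
  · have h1 := hanti hy hx hxy
    simp only at h1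
    rw [abs_of_nonpos (by linarith), ← mul_le_mul_iff_of_pos_right (Real.exp_pos (-B * x))]
    refine h1.trans_eq ?_
    rw [mul_right_comm, ← Real.exp_add, mul_comm]
    ring_nf

section

variable {α β : ℝ} (hα : -1 < α) (hβ : -1 < β)

/-- The energy `λ_n p_n² + (1 - X²) p_n'²` of the `n`-th Jacobi polynomial. -/
def jacobiEnergy (n : ℕ) : ℝ[X] :=
  C (jacobiEigenvalue α β n) * jacobiPoly hα hβ n ^ 2 +
    (1 - X ^ 2) * derivative (jacobiPoly hα hβ n) ^ 2

lemma eval_jacobiEnergy (n : ℕ) (x : ℝ) : (jacobiEnergy hα hβ n).eval x =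
    jacobiEigenvalue α β n * (jacobiPoly hα hβ n).eval x ^ 2 +
      (1 - x ^ 2) * (derivative (jacobiPoly hα hβ n)).eval x ^ 2 := by
  simp [jacobiEnergy]

lemma derivative_jacobiEnergy (n : ℕ) : derivative (jacobiEnergy hα hβ n) =
    -2 * (X + jacobiDrift α β) * derivative (jacobiPoly hα hβ n) ^ 2 := by
  have h := jacobiPoly_ode hα hβ n
  simp only [jacobiEnergy, sq, derivative_mul, derivative_add, derivative_sub, derivative_X,
    derivative_C, derivative_one] at h ⊢
  linear_combination 2 * derivative (jacobiPoly hα hβ n) * h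

lemma jacobiFunctional_jacobiEnergy (n : ℕ) :
    jacobiFunctional hα hβ (jacobiEnergy hα hβ n) = 2 * jacobiEigenvalue α β n := by
  rw [jacobiEnergy, map_add, ← smul_eq_C_mul, map_smul, jacobiFunctional_jacobiPoly_sq,
    jacobiFunctional_deriv_sq, smul_eq_mul]
  ring

lemma one_sub_sq_ge {η x : ℝ} (hη : 0 < η) (hη1 : η ≤ 1)
    (hx : x ∈ Set.Icc (-1 + η) (1 - η)) : η ≤ 1 - x ^ 2 := by
  nlinarith [mul_nonneg (by linarith [hx.1] : 0 ≤ x - (-1 + η))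
    (by linarith [hx.2] : 0 ≤ 1 - η - x)]

lemma one_sub_sq_le {η x : ℝ} (hx : x ∈ Set.Icc (-1 : ℝ) 1)
    (hx' : x ∉ Set.Icc (-1 + η) (1 - η)) : 1 - x ^ 2 ≤ 2 * η := by
  rw [Set.mem_Icc, not_and_or, not_le, not_le] at hx'
  rcases hx' with h | h
  · nlinarith [hx.1, hx.2]
  · nlinarith [hx.1, hx.2]

/-- A bound for the drift and its shift by `X` on `[-1, 1]`. -/
def driftBound (α β : ℝ) : ℝ := 1 + |β - α| + |α + β + 2|

lemma driftBound_pos (α β : ℝ) : 0 < driftBound α β := by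
  rw [driftBound]; positivity

lemma abs_drift_le {x : ℝ} (hx : x ∈ Set.Icc (-1 : ℝ) 1) :
    |(jacobiDrift α β).eval x| ≤ driftBound α β - 1 := by
  rw [eval_jacobiDrift, driftBound]
  have h1 : |(α + β + 2) * x| ≤ |α + β + 2| := by
    rw [abs_mul]
    exact mul_le_of_le_one_right (abs_nonneg _) (abs_le.2 hx)
  linarith [abs_sub (β - α) ((α + β + 2) * x)]

/-- The values of the energy at two interior points are comparable, uniformly in `n`. -/
lemma jacobiEnergy_le_mul {η : ℝ} (hη : 0 < η) (hη1 : η ≤ 1) (n : ℕ) {x y : ℝ}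
    (hx : x ∈ Set.Icc (-1 + η) (1 - η)) (hy : y ∈ Set.Icc (-1 + η) (1 - η)) :
    (jacobiEnergy hα hβ n).eval x ≤
      Real.exp (2 * driftBound α β / η * ((1 - η) - (-1 + η))) *
        (jacobiEnergy hα hβ n).eval y := by
  have hD := driftBound_pos α β
  have hpos : 0 ≤ jacobiEigenvalue α β n := by
    rcases eq_or_ne n 0 with rfl | hn
    · simp [jacobiEigenvalue]
    · exact (jacobiEigenvalue_pos hα hβ hn).le
  refine le_exp_mul_of_abs_deriv_le (fun x => (jacobiEnergy hα hβ n).hasDerivAt x) (by positivity)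
    (fun z hz => ?_) (fun z hz => ?_) hx hy
  · rw [eval_jacobiEnergy]
    have := one_sub_sq_ge hη hη1 hz
    have : 0 ≤ 1 - z ^ 2 := hη.le.trans this
    positivity
  · have h1 := one_sub_sq_ge hη hη1 hz
    have hz' : z ∈ Set.Icc (-1 : ℝ) 1 := ⟨by linarith [hz.1], by linarith [hz.2]⟩
    rw [derivative_jacobiEnergy, eval_jacobiEnergy]
    simp only [eval_mul, eval_add, eval_pow, eval_neg, eval_ofNat, eval_X]
    set u := (derivative (jacobiPoly hα hβ n)).eval z
    set v := (jacobiPoly hα hβ n).eval z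
    have h2 : |z + (jacobiDrift α β).eval z| ≤ driftBound α β := by
      have := abs_drift_le (α := α) (β := β) hz'
      linarith [abs_add_le z ((jacobiDrift α β).eval z), abs_le.2 hz']
    calc |-2 * (z + (jacobiDrift α β).eval z) * u ^ 2|
        = 2 * |z + (jacobiDrift α β).eval z| * u ^ 2 := by
          rw [abs_mul, abs_mul, abs_of_nonneg (sq_nonneg u)]
          norm_num
      _ ≤ 2 * driftBound α β * u ^ 2 := by gcongr
      _ = 2 * driftBound α β / η * (η * u ^ 2) := by field_simp
      _ ≤ 2 * driftBound α β / η * (jacobiEigenvalue α β n * v ^ 2 + (1 - z ^ 2) * u ^ 2) := by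
          gcongr
          nlinarith [mul_nonneg hpos (sq_nonneg v),
            mul_le_mul_of_nonneg_right h1 (sq_nonneg u)]

/-- A polynomial that is nonnegative on `[-1, 1]` is at some interior point not larger than a
multiple of its integral. The test function `(1 - t²) - 2 η` is negative outside the smaller
interval. -/
lemma exists_eval_mul_le {η : ℝ} (hη : 0 < η) (hη1 : η < 1) {Q : ℝ[X]}
    (hQ : ∀ t ∈ Set.Icc (-1 : ℝ) 1, 0 ≤ Q.eval t) :
    ∃ x ∈ Set.Icc (-1 + η) (1 - η), Q.eval x *
      (jacobiFunctional hα hβ (1 - X ^ 2) - 2 * η * jacobiFunctional hα hβ 1) ≤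
        jacobiFunctional hα hβ Q := by
  obtain ⟨x, hx, hmin⟩ := isCompact_Icc.exists_isMinOn (Set.nonempty_Icc.2 (by linarith))
    (Q.continuous.continuousOn (s := Set.Icc (-1 + η) (1 - η)))
  refine ⟨x, hx, ?_⟩
  have hx0 : 0 ≤ Q.eval x := hQ x ⟨by linarith [hx.1], by linarith [hx.2]⟩
  have h : jacobiFunctional hα hβ (Q.eval x • ((1 - X ^ 2) - (2 * η) • 1)) ≤
      jacobiFunctional hα hβ Q := by
    refine jacobiFunctional_mono hα hβ fun t ht => ?_
    simp only [eval_smul, eval_sub, eval_one, eval_pow, eval_X, smul_eq_mul, mul_one]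
    by_cases hti : t ∈ Set.Icc (-1 + η) (1 - η)
    · refine le_trans ?_ (hmin hti)
      exact mul_le_of_le_one_right hx0 (by nlinarith)
    · refine le_trans ?_ (hQ t ht)
      exact mul_nonpos_of_nonneg_of_nonpos hx0 (by linarith [one_sub_sq_le ht hti])
  rwa [map_smul, map_sub, map_smul, smul_eq_mul, smul_eq_mul] at h

/-- A polynomial that is nonnegative on `[-1, 1]` and whose mass is not concentrated at the ends
is somewhere in the interior not too small. -/
lemma exists_le_eval_mul {η : ℝ} (hη : 0 < η) (hη1 : η < 1) {Q : ℝ[X]}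
    (hQ : ∀ t ∈ Set.Icc (-1 : ℝ) 1, 0 ≤ Q.eval t) :
    ∃ x ∈ Set.Icc (-1 + η) (1 - η), jacobiFunctional hα hβ ((1 - X ^ 2) * Q) ≤
      Q.eval x * jacobiFunctional hα hβ 1 + 2 * η * jacobiFunctional hα hβ Q := by
  obtain ⟨x, hx, hmax⟩ := isCompact_Icc.exists_isMaxOn (Set.nonempty_Icc.2 (by linarith))
    (Q.continuous.continuousOn (s := Set.Icc (-1 + η) (1 - η)))
  refine ⟨x, hx, ?_⟩
  have hx0 : 0 ≤ Q.eval x := hQ x ⟨by linarith [hx.1], by linarith [hx.2]⟩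
  have h : jacobiFunctional hα hβ ((1 - X ^ 2) * Q) ≤
      jacobiFunctional hα hβ (Q.eval x • 1 + (2 * η) • Q) := by
    refine jacobiFunctional_mono hα hβ fun t ht => ?_
    simp only [eval_smul, eval_sub, eval_add, eval_mul, eval_one, eval_pow, eval_X, smul_eq_mul,
      mul_one]
    have h0 := hQ t ht
    by_cases hti : t ∈ Set.Icc (-1 + η) (1 - η)
    · have h1 : Q.eval t ≤ Q.eval x := hmax hti
      nlinarith [mul_nonneg hη.le h0, mul_nonneg (sq_nonneg t) h0]
    · have := mul_le_mul_of_nonneg_right (one_sub_sq_le ht hti) h0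
      linarith
  rwa [map_add, map_smul, map_smul, smul_eq_mul, smul_eq_mul] at h

end

/-! ### Bounds for the one-dimensional kernels -/

section

variable {α β : ℝ} (hα : -1 < α) (hβ : -1 < β)

lemma jacobiFunctional_one_pos : 0 < jacobiFunctional hα hβ 1 := by
  simpa using jacobiFunctional_sq_pos hα hβ (one_ne_zero (α := ℝ[X]))

lemma jacobiFunctional_one_sub_sq_pos : 0 < jacobiFunctional hα hβ (1 - X ^ 2) := by
  have h := jacobiFunctional_sq_pos hα hβ (P := 1 - X ^ 2) (fun h => by
    have := congrArg (eval 0) h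
    simp at this)
  refine h.trans_le (jacobiFunctional_mono hα hβ fun t ht => ?_)
  simp only [eval_mul, eval_sub, eval_one, eval_pow, eval_X]
  have : t ^ 2 ≤ 1 := by nlinarith [ht.1, ht.2]
  nlinarith [sq_nonneg t]

lemma eval_jacobiEnergy_nonneg (n : ℕ) {t : ℝ} (ht : t ∈ Set.Icc (-1 : ℝ) 1) :
    0 ≤ (jacobiEnergy hα hβ n).eval t := by
  rw [eval_jacobiEnergy]
  have h1 : 0 ≤ 1 - t ^ 2 := by nlinarith [ht.1, ht.2]
  have h2 : 0 ≤ jacobiEigenvalue α β n := by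
    rcases eq_or_ne n 0 with rfl | hn
    · simp [jacobiEigenvalue]
    · exact (jacobiEigenvalue_pos hα hβ hn).le
  positivity

/-- The scale of the energy of `p_n` inside the interval is its eigenvalue: the upper bound. -/
lemma exists_jacobiEnergy_le {η : ℝ} (hη : 0 < η) (hη1 : η < 1)
    (hη2 : 2 * η * jacobiFunctional hα hβ 1 < jacobiFunctional hα hβ (1 - X ^ 2)) :
    ∃ C : ℝ, 0 < C ∧ ∀ n : ℕ, ∀ x ∈ Set.Icc (-1 + η) (1 - η),
      (jacobiEnergy hα hβ n).eval x ≤ C * jacobiEigenvalue α β n := by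
  set e := Real.exp (2 * driftBound α β / η * ((1 - η) - (-1 + η))) with he
  set m := jacobiFunctional hα hβ (1 - X ^ 2) - 2 * η * jacobiFunctional hα hβ 1 with hm
  have hm0 : 0 < m := by linarith
  have he0 : 0 < e := Real.exp_pos _
  refine ⟨e * (2 / m), by positivity, fun n x hx => ?_⟩
  obtain ⟨y, hy, hle⟩ := exists_eval_mul_le hα hβ hη hη1
    (Q := jacobiEnergy hα hβ n) fun t ht => eval_jacobiEnergy_nonneg hα hβ n ht
  rw [jacobiFunctional_jacobiEnergy, ← hm, ← le_div_iff₀ hm0] at hle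
  calc (jacobiEnergy hα hβ n).eval x ≤ e * (jacobiEnergy hα hβ n).eval y :=
        jacobiEnergy_le_mul hα hβ hη hη1.le n hx hy
    _ ≤ e * (2 * jacobiEigenvalue α β n / m) := by gcongr
    _ = e * (2 / m) * jacobiEigenvalue α β n := by ring

/-- The scale of the energy of `p_n` inside the interval is its eigenvalue: the lower bound. -/
lemma exists_le_jacobiEnergy {η : ℝ} (hη : 0 < η) (hη1 : η ≤ 1 / 16) :
    ∃ c : ℝ, 0 < c ∧ ∃ n₀ : ℕ, ∀ n ≥ n₀, ∀ x ∈ Set.Icc (-1 + η) (1 - η),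
      c * jacobiEigenvalue α β n ≤ (jacobiEnergy hα hβ n).eval x := by
  set e := Real.exp (2 * driftBound α β / η * ((1 - η) - (-1 + η))) with he
  have he0 : 0 < e := Real.exp_pos _
  have hone := jacobiFunctional_one_pos hα hβ
  set m := jacobiFunctional hα hβ 1 with hm
  obtain ⟨G, hG⟩ := exists_virial_bound hα hβ
  obtain ⟨n₀, hn₀⟩ := exists_nat_ge (G / 2 + 2)
  refine ⟨(e * (8 * m))⁻¹, by positivity, max n₀ 2, fun n hn x hx => ?_⟩
  have hn1 : G / 2 + 2 ≤ n := hn₀.trans (by exact_mod_cast (le_max_left _ _).trans hn)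
  have hn2 : (2 : ℝ) ≤ n := by exact_mod_cast (le_max_right _ _).trans hn
  have hlam : G / 2 ≤ jacobiEigenvalue α β n := by
    have := mul_pred_le_jacobiEigenvalue hα hβ n
    nlinarith
  have hlam0 : 0 < jacobiEigenvalue α β n :=
    jacobiEigenvalue_pos hα hβ (by rintro rfl; norm_num at hn2)
  set l := jacobiEigenvalue α β n
  have hvir : 1 / 4 ≤ jacobiFunctional hα hβ ((1 - X ^ 2) * jacobiPoly hα hβ n ^ 2) := by
    have h1 : 8 * l * (1 / 4) ≤
        8 * l * jacobiFunctional hα hβ ((1 - X ^ 2) * jacobiPoly hα hβ n ^ 2) := by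
      linarith [hG n]
    exact le_of_mul_le_mul_left h1 (by positivity)
  obtain ⟨y, hy, hle⟩ := exists_le_eval_mul hα hβ hη (by linarith)
    (Q := jacobiPoly hα hβ n ^ 2) fun t _ => by rw [eval_pow]; exact sq_nonneg _
  rw [jacobiFunctional_jacobiPoly_sq, eval_pow, ← hm] at hle
  have hy2 : 1 / (8 * m) ≤ (jacobiPoly hα hβ n).eval y ^ 2 := by
    rw [div_le_iff₀ (by positivity)]
    linarith
  have hEy : l * (1 / (8 * m)) ≤ (jacobiEnergy hα hβ n).eval y := by
    rw [eval_jacobiEnergy]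
    have h1 : 0 ≤ 1 - y ^ 2 := hη.le.trans (one_sub_sq_ge hη (by linarith) hy)
    have h2 := mul_le_mul_of_nonneg_left hy2 hlam0.le
    have h3 := mul_nonneg h1 (sq_nonneg ((derivative (jacobiPoly hα hβ n)).eval y))
    linarith
  have h := hEy.trans (jacobiEnergy_le_mul hα hβ hη (by linarith) n hy hx)
  calc (e * (8 * m))⁻¹ * l = e⁻¹ * (l * (1 / (8 * m))) := by field_simp
    _ ≤ e⁻¹ * (e * (jacobiEnergy hα hβ n).eval x) := by gcongr
    _ = (jacobiEnergy hα hβ n).eval x := by field_simp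

/-- Inside the interval, the orthonormal polynomials are bounded and their derivatives grow at
most linearly. -/
lemma exists_jacobiPoly_bounds {η : ℝ} (hη : 0 < η) (hη1 : η < 1)
    (hη2 : 2 * η * jacobiFunctional hα hβ 1 < jacobiFunctional hα hβ (1 - X ^ 2)) :
    ∃ C : ℝ, 0 < C ∧ ∀ n : ℕ, ∀ x ∈ Set.Icc (-1 + η) (1 - η),
      |(jacobiPoly hα hβ n).eval x| ≤ C ∧
        |(derivative (jacobiPoly hα hβ n)).eval x| ≤ C * (n + 1) := by
  obtain ⟨C, hC, hE⟩ := exists_jacobiEnergy_le hα hβ hη hη1 hη2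
  have hs : 0 < α + β + 3 := by linarith
  set A := √(C * (α + β + 3) / η) with hA
  set p₀ := (jacobiPoly hα hβ 0).coeff 0 with hp₀
  have h0 : jacobiPoly hα hβ 0 = Polynomial.C p₀ :=
    eq_C_of_natDegree_eq_zero (natDegree_jacobiPoly hα hβ 0)
  refine ⟨√C + A + |p₀|, by positivity, fun n x hx => ?_⟩
  have hx2 := one_sub_sq_ge hη hη1.le hx
  rcases eq_or_ne n 0 with rfl | hn
  · rw [h0]
    simp only [eval_C, derivative_C, eval_zero, abs_zero]
    exact ⟨le_add_of_nonneg_left (by positivity), by positivity⟩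
  have hl := jacobiEigenvalue_pos hα hβ hn
  have h := hE n x hx
  rw [eval_jacobiEnergy] at h
  have hl2 := jacobiEigenvalue_le hα hβ n
  set l := jacobiEigenvalue α β n
  set v := (jacobiPoly hα hβ n).eval x
  set u := (derivative (jacobiPoly hα hβ n)).eval x
  have hv : v ^ 2 ≤ C := by
    have : l * v ^ 2 ≤ l * C := by nlinarith [mul_nonneg (hη.le.trans hx2) (sq_nonneg u)]
    exact le_of_mul_le_mul_left this hl
  have hu : u ^ 2 ≤ (A * (n + 1)) ^ 2 := by
    rw [mul_pow, hA, Real.sq_sqrt (by positivity), div_mul_eq_mul_div, le_div_iff₀ hη]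
    nlinarith [mul_nonneg hl.le (sq_nonneg v), mul_le_mul_of_nonneg_right hx2 (sq_nonneg u),
      mul_le_mul_of_nonneg_left hl2 hC.le]
  have hA0 : 0 ≤ A := Real.sqrt_nonneg _
  constructor
  · have := Real.abs_le_sqrt hv
    linarith [abs_nonneg p₀]
  · have h2 : |u| ≤ A * (n + 1) := abs_le_of_sq_le_sq hu (by positivity)
    have h3 : 0 ≤ (√C + |p₀|) * ((n : ℝ) + 1) := by positivity
    linarith

end

section

variable {α β : ℝ} (hα : -1 < α) (hβ : -1 < β)

lemma eval_jacobiKernel (n : ℕ) (x : ℝ) : (jacobiKernel hα hβ n).eval x =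
    ∑ k ∈ Finset.range n, (jacobiPoly hα hβ k).eval x ^ 2 := by
  simp [jacobiKernel, eval_finsetSum]

lemma eval_jacobiKernel_le {C x : ℝ} (h : ∀ n, |(jacobiPoly hα hβ n).eval x| ≤ C) (n : ℕ) :
    (jacobiKernel hα hβ n).eval x ≤ C ^ 2 * n := by
  rw [eval_jacobiKernel]
  refine (Finset.sum_le_card_nsmul _ _ (C ^ 2) fun k _ => ?_).trans_eq ?_
  · exact sq_le_sq' (neg_le_of_abs_le (h k)) (le_of_abs_le (h k))
  · simp [mul_comm]

lemma abs_jacobiRecurrence_mul_le (n : ℕ) :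
    |jacobiRecurrence hα hβ n * (2 * n + α + β + 2)| ≤ (α + β + 4) * (n + 1) := by
  have hn : (0 : ℝ) ≤ n := n.cast_nonneg
  rw [abs_mul, abs_of_nonneg (by linarith : (0 : ℝ) ≤ 2 * n + α + β + 2)]
  refine (mul_le_of_le_one_left (by linarith) (abs_jacobiRecurrence_le hα hβ n)).trans ?_
  nlinarith [mul_nonneg (by linarith : 0 ≤ α + β + 2) hn]

/-- The derivative of the kernel is only of order `n`, although its terms are of order `n` each. -/
lemma abs_deriv_jacobiKernel_le {η C x : ℝ} (hη : 0 < η) (hη1 : η < 1)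
    (hx : x ∈ Set.Icc (-1 + η) (1 - η)) (h : ∀ n, |(jacobiPoly hα hβ n).eval x| ≤ C) (n : ℕ) :
    |(derivative (jacobiKernel hα hβ n)).eval x| ≤
      (driftBound α β + (α + β + 4)) * C ^ 2 / η * n := by
  rcases n with _ | n
  · simp [jacobiKernel]
  have hC : 0 ≤ C := (abs_nonneg _).trans (h 0)
  have hK := eval_jacobiKernel_le hα hβ h (n + 1)
  have hK0 : 0 ≤ (jacobiKernel hα hβ (n + 1)).eval x := by
    rw [eval_jacobiKernel]
    exact Finset.sum_nonneg fun k _ => sq_nonneg _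
  have hq := abs_drift_le (α := α) (β := β) (x := x) ⟨by linarith [hx.1], by linarith [hx.2]⟩
  have ha := abs_jacobiRecurrence_mul_le hα hβ n
  have hd := congrArg (eval x) (deriv_jacobiKernel hα hβ n)
  simp only [eval_mul, eval_sub, eval_neg, eval_C, eval_one, eval_pow, eval_X] at hd
  have hx2 := one_sub_sq_ge hη hη1.le hx
  push_cast at hK ⊢
  set K := (jacobiKernel hα hβ (n + 1)).eval x
  set K' := (derivative (jacobiKernel hα hβ (n + 1))).eval x
  set q := (jacobiDrift α β).eval x
  set r := jacobiRecurrence hα hβ n * (2 * n + α + β + 2)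
  set u := (jacobiPoly hα hβ n).eval x
  set v := (jacobiPoly hα hβ (n + 1)).eval x
  have huv : |u * v| ≤ C ^ 2 := by
    rw [abs_mul, sq]
    exact mul_le_mul (h n) (h (n + 1)) (abs_nonneg _) hC
  rw [div_mul_eq_mul_div, le_div_iff₀ hη]
  calc |K'| * η ≤ |K'| * (1 - x ^ 2) := by gcongr
    _ = |(1 - x ^ 2) * K'| := by
      rw [abs_mul, abs_of_nonneg (hη.le.trans hx2), mul_comm]
    _ = |-q * K - r * (u * v)| := by rw [hd]
    _ ≤ |q| * K + |r| * |u * v| := by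
      refine (abs_sub _ _).trans_eq ?_
      rw [abs_mul, abs_mul, abs_neg, abs_of_nonneg hK0]
    _ ≤ driftBound α β * (C ^ 2 * (n + 1)) + (α + β + 4) * (n + 1) * C ^ 2 := by
      have := driftBound_pos α β
      have hs : 0 ≤ (α + β + 4) * ((n : ℝ) + 1) := mul_nonneg (by linarith) (by positivity)
      gcongr
      linarith
    _ = (driftBound α β + (α + β + 4)) * C ^ 2 * (n + 1) := by ring

lemma abs_jacobiKernel_sub_le {η C x y : ℝ} (hη : 0 < η) (hη1 : η < 1)
    (h : ∀ n, ∀ x ∈ Set.Icc (-1 + η) (1 - η), |(jacobiPoly hα hβ n).eval x| ≤ C)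
    (hx : x ∈ Set.Icc (-1 + η) (1 - η)) (hy : y ∈ Set.Icc (-1 + η) (1 - η)) (n : ℕ) :
    |(jacobiKernel hα hβ n).eval x - (jacobiKernel hα hβ n).eval y| ≤
      (driftBound α β + (α + β + 4)) * C ^ 2 / η * n * |x - y| := by
  refine (convex_Icc (-1 + η) (1 - η)).norm_image_sub_le_of_norm_deriv_le
    (fun z _ => (jacobiKernel hα hβ n).differentiableAt) (fun z hz => ?_) hy hx
  rw [Polynomial.deriv]
  exact abs_deriv_jacobiKernel_le hα hβ hη hη1 hz (fun n => h n z hz) n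

/-- The Jacobi differential operator applied to the kernel, in two ways. -/
lemma operator_jacobiKernel (n : ℕ) :
    ∑ k ∈ Finset.range (n + 1), (2 * jacobiEnergy hα hβ k -
      4 * (C (jacobiEigenvalue α β k) * jacobiPoly hα hβ k ^ 2)) =
    2 * X * derivative (jacobiKernel hα hβ (n + 1)) +
      C (α + β + 2) * jacobiKernel hα hβ (n + 1) -
        C (jacobiRecurrence hα hβ n * (2 * n + α + β + 2)) *
          (derivative (jacobiPoly hα hβ n) * jacobiPoly hα hβ (n + 1) +
            jacobiPoly hα hβ n * derivative (jacobiPoly hα hβ (n + 1))) := by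
  have h1 : ∑ k ∈ Finset.range (n + 1), (2 * jacobiEnergy hα hβ k -
      4 * (C (jacobiEigenvalue α β k) * jacobiPoly hα hβ k ^ 2)) =
      (1 - X ^ 2) * derivative (derivative (jacobiKernel hα hβ (n + 1))) +
        jacobiDrift α β * derivative (jacobiKernel hα hβ (n + 1)) := by
    rw [jacobiKernel, derivative_sum, derivative_sum, Finset.mul_sum, Finset.mul_sum,
      ← Finset.sum_add_distrib]
    refine Finset.sum_congr rfl fun k _ => ?_
    rw [operator_jacobiPoly_sq, jacobiEnergy]
    ring
  have h2 := congrArg derivative (deriv_jacobiKernel hα hβ n)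
  simp only [sq, derivative_mul, derivative_sub, derivative_neg, derivative_C, derivative_one,
    derivative_X, derivative_jacobiDrift] at h2
  rw [h1]
  linear_combination h2

lemma sum_mul_pred (m : ℕ) :
    ∑ k ∈ Finset.range m, ((k : ℝ) * (k - 1)) = m * (m - 1) * (m - 2) / 3 := by
  induction m with
  | zero => simp
  | succ m ih =>
    rw [Finset.sum_range_succ, ih]
    push_cast
    ring

/-- The halves `∑ λ_k p_k²` and `∑ (1 - x²) p_k'²` of the total energy, which are of order `n³`,
differ by `O(n²)`. -/
lemma sum_jacobiEnergy_sub_le {η C x : ℝ} (hη : 0 < η) (hη1 : η < 1)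
    (hx : x ∈ Set.Icc (-1 + η) (1 - η))
    (hp : ∀ n : ℕ, |(jacobiPoly hα hβ n).eval x| ≤ C ∧
      |(derivative (jacobiPoly hα hβ n)).eval x| ≤ C * (n + 1)) (n : ℕ) :
    2 * ∑ k ∈ Finset.range (n + 1), (jacobiEnergy hα hβ k).eval x -
      4 * ∑ k ∈ Finset.range (n + 1),
        jacobiEigenvalue α β k * (jacobiPoly hα hβ k).eval x ^ 2 ≤
      (2 * ((driftBound α β + (α + β + 4)) * C ^ 2 / η) + (α + β + 2) * C ^ 2 +
        3 * (α + β + 4) * C ^ 2) * ((n : ℝ) + 1) ^ 2 := by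
  have hC : 0 ≤ C := (abs_nonneg _).trans (hp 0).1
  have hs : 0 < α + β + 2 := by linarith
  have hKC := eval_jacobiKernel_le hα hβ (fun n => (hp n).1) (n + 1)
  have hK' := abs_deriv_jacobiKernel_le hα hβ hη hη1 hx (fun n => (hp n).1) (n + 1)
  push_cast at hKC hK'
  have hD := driftBound_pos α β
  set L := (driftBound α β + (α + β + 4)) * C ^ 2 / η with hL
  have hL0 : 0 ≤ L := by
    have : 0 < driftBound α β + (α + β + 4) := by linarith
    positivity
  have hm : (1 : ℝ) ≤ (n : ℝ) + 1 := by linarith [n.cast_nonneg (α := ℝ)]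
  have h := congrArg (eval x) (operator_jacobiKernel hα hβ n)
  simp only [eval_finsetSum, eval_sub, eval_mul, eval_add, eval_C, eval_pow, eval_X,
    eval_ofNat, Finset.sum_sub_distrib, ← Finset.mul_sum] at h
  rw [h]
  have ha := abs_jacobiRecurrence_mul_le hα hβ n
  have hx1 : |x| ≤ 1 := abs_le.2 ⟨by linarith [hx.1], by linarith [hx.2]⟩
  obtain ⟨b1, b2⟩ := hp n
  obtain ⟨b3, b4⟩ := hp (n + 1)
  push_cast at b4
  set m : ℝ := (n : ℝ) + 1 with hmn
  set K := (jacobiKernel hα hβ (n + 1)).eval x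
  set u := (jacobiPoly hα hβ n).eval x
  set v := (jacobiPoly hα hβ (n + 1)).eval x
  set u' := (derivative (jacobiPoly hα hβ n)).eval x
  set v' := (derivative (jacobiPoly hα hβ (n + 1))).eval x
  set K' := (derivative (jacobiKernel hα hβ (n + 1))).eval x
  set r := jacobiRecurrence hα hβ n * (2 * n + α + β + 2)
  have t1 : 2 * x * K' ≤ 2 * L * m := by
    have : |x * K'| ≤ 1 * (L * m) := by
      rw [abs_mul]
      exact mul_le_mul hx1 hK' (abs_nonneg _) zero_le_one
    linarith [le_abs_self (x * K')]
  have t2 : |u' * v + u * v'| ≤ 3 * C ^ 2 * m := by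
    have e1 : |u' * v| ≤ C * m * C := by
      rw [abs_mul]
      exact mul_le_mul b2 b3 (abs_nonneg _) (by positivity)
    have e2 : |u * v'| ≤ C * (C * (m + 1)) := by
      rw [abs_mul]
      exact mul_le_mul b1 b4 (abs_nonneg _) hC
    have e3 : C * (C * (m + 1)) ≤ C * (C * (m + m)) := by gcongr
    refine (abs_add_le _ _).trans ((add_le_add e1 (e2.trans e3)).trans_eq (by ring))
  have t3 : -(r * (u' * v + u * v')) ≤ 3 * (α + β + 4) * C ^ 2 * m ^ 2 := by
    refine (neg_le_abs _).trans ?_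
    rw [abs_mul]
    refine (mul_le_mul ha t2 (abs_nonneg _)
      (mul_nonneg (by linarith) (by linarith))).trans_eq (by ring)
  have t4 : (α + β + 2) * K ≤ (α + β + 2) * (C ^ 2 * m) := by gcongr
  have t5 : m ≤ m ^ 2 := by nlinarith
  have t6 : 2 * L * m + (α + β + 2) * (C ^ 2 * m) ≤
      (2 * L + (α + β + 2) * C ^ 2) * m ^ 2 := by
    rw [← mul_assoc, ← add_mul]
    gcongr
  linarith

/-- Two-sided information on the kernel inside the interval. For the lower bound, the energies
`E_k = λ_k p_k² + (1 - x²) p_k'²` sum up to order `n³`, and the two halves of the sum differ by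
`O(n²)`; therefore `∑_{k < n} λ_k p_k²` is of order `n³` as well, whereas it is at most a multiple
of `n² ∑_{k < n} p_k²`. -/
theorem exists_jacobiKernel_bounds {ε : ℝ} (hε : 0 < ε) :
    ∃ C c : ℝ, 0 < C ∧ 0 < c ∧
      (∀ n : ℕ, ∀ x ∈ Set.Icc (-1 + ε) (1 - ε), (jacobiPoly hα hβ n).eval x ^ 2 ≤ C) ∧
      (∀ n : ℕ, ∀ x ∈ Set.Icc (-1 + ε) (1 - ε),
        c * (n + 1) ≤ (jacobiKernel hα hβ (n + 1)).eval x) ∧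
      (∀ n : ℕ, ∀ x ∈ Set.Icc (-1 + ε) (1 - ε), ∀ y ∈ Set.Icc (-1 + ε) (1 - ε),
        |(jacobiKernel hα hβ n).eval x - (jacobiKernel hα hβ n).eval y| ≤ C * n * |x - y|) := by
  have hone := jacobiFunctional_one_pos hα hβ
  have hone' := jacobiFunctional_one_sub_sq_pos hα hβ
  -- The estimates need an interval that carries a fixed part of the mass.
  obtain ⟨η, hη, hηε, hη16, hηm⟩ : ∃ η : ℝ, 0 < η ∧ η ≤ ε ∧ η ≤ 1 / 16 ∧
      2 * η * jacobiFunctional hα hβ 1 < jacobiFunctional hα hβ (1 - X ^ 2) := by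
    set r := jacobiFunctional hα hβ (1 - X ^ 2) / (4 * jacobiFunctional hα hβ 1) with hr
    have hr0 : 0 < r := by positivity
    refine ⟨min ε (min (1 / 16) r), by positivity, min_le_left _ _,
      (min_le_right _ _).trans (min_le_left _ _), ?_⟩
    have h1 : min ε (min (1 / 16) r) ≤ r := (min_le_right _ _).trans (min_le_right _ _)
    calc 2 * min ε (min (1 / 16) r) * jacobiFunctional hα hβ 1
        ≤ 2 * r * jacobiFunctional hα hβ 1 := by gcongr
      _ = jacobiFunctional hα hβ (1 - X ^ 2) / 2 := by rw [hr]; field_simp; norm_num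
      _ < jacobiFunctional hα hβ (1 - X ^ 2) := by linarith
  have hη1 : η < 1 := by linarith
  have hsub : Set.Icc (-1 + ε) (1 - ε) ⊆ Set.Icc (-1 + η) (1 - η) :=
    Set.Icc_subset_Icc (by linarith) (by linarith)
  obtain ⟨C, hC, hp⟩ := exists_jacobiPoly_bounds hα hβ hη hη1 hηm
  obtain ⟨c, hc, n₀, hE⟩ := exists_le_jacobiEnergy hα hβ hη hη16
  have hD := driftBound_pos α β
  have hs : 0 < α + β + 2 := by linarith
  set L := (driftBound α β + (α + β + 4)) * C ^ 2 / η with hL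
  have hL0 : 0 < L := by
    have : 0 < driftBound α β + (α + β + 4) := by linarith
    positivity
  set p₀ := (jacobiPoly hα hβ 0).coeff 0 with hp₀
  have h0 : jacobiPoly hα hβ 0 = Polynomial.C p₀ :=
    eq_C_of_natDegree_eq_zero (natDegree_jacobiPoly hα hβ 0)
  have hp₀' : 0 < p₀ ^ 2 := by
    refine sq_pos_of_ne_zero fun h => ?_
    have h1 := jacobiFunctional_jacobiPoly_sq hα hβ 0
    rw [h0, h] at h1
    simp at h1
  set M := 2 * L + (α + β + 2) * C ^ 2 + 3 * (α + β + 4) * C ^ 2 with hM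
  have hM0 : 0 < M := by
    have : 0 < α + β + 4 := by linarith
    positivity
  set R := M / 2 + c * n₀ ^ 2 + c with hR
  have hR0 : 0 < R := by positivity
  refine ⟨C ^ 2 + L, c / 12 / (2 * (α + β + 3) + R / p₀ ^ 2), by positivity,
    div_pos (by positivity) (by have : 0 < α + β + 3 := by linarith
                                positivity), ?_, ?_, ?_⟩
  · intro n x hx
    have h := (hp n x (hsub hx)).1
    have := sq_le_sq' (neg_le_of_abs_le h) (le_of_abs_le h)
    linarith
  · intro n x hx
    replace hx := hsub hx
    set K := (jacobiKernel hα hβ (n + 1)).eval x with hK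
    have hm : (1 : ℝ) ≤ (n : ℝ) + 1 := by linarith [n.cast_nonneg (α := ℝ)]
    set m : ℝ := (n : ℝ) + 1 with hmn
    have hKp : p₀ ^ 2 ≤ K := by
      rw [hK, eval_jacobiKernel, Finset.sum_range_succ', h0, eval_C]
      exact le_add_of_nonneg_left (Finset.sum_nonneg fun k _ => sq_nonneg _)
    have hop := sum_jacobiEnergy_sub_le hα hβ hη hη1 hx (fun n => hp n x hx) n
    rw [← hL, ← hM, ← hmn] at hop
    have hT : ∑ k ∈ Finset.range (n + 1),
        jacobiEigenvalue α β k * (jacobiPoly hα hβ k).eval x ^ 2 ≤ (α + β + 3) * m ^ 2 * K := by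
      rw [hK, eval_jacobiKernel, Finset.mul_sum]
      refine Finset.sum_le_sum fun k hk => mul_le_mul_of_nonneg_right ?_ (sq_nonneg _)
      refine (jacobiEigenvalue_le hα hβ k).trans ?_
      have hk' : (k : ℝ) ≤ n := by exact_mod_cast Nat.lt_succ_iff.1 (Finset.mem_range.1 hk)
      have : 0 < α + β + 3 := by linarith
      rw [hmn]
      gcongr
    have hElow : c * (m * (m - 1) * (m - 2) / 3) - c * n₀ ^ 2 * m ≤
        ∑ k ∈ Finset.range (n + 1), (jacobiEnergy hα hβ k).eval x := by
      have h1 : ∑ k ∈ Finset.range (n + 1), (c * ((k : ℝ) * (k - 1)) - c * n₀ ^ 2) ≤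
          ∑ k ∈ Finset.range (n + 1), (jacobiEnergy hα hβ k).eval x := by
        refine Finset.sum_le_sum fun k _ => ?_
        rcases le_or_gt n₀ k with hk | hk
        · have e1 := hE k hk x hx
          have e2 := mul_le_mul_of_nonneg_left (mul_pred_le_jacobiEigenvalue hα hβ k) hc.le
          have e3 : 0 ≤ c * (n₀ : ℝ) ^ 2 := by positivity
          linarith
        · have e1 := eval_jacobiEnergy_nonneg hα hβ k (t := x)
            ⟨by linarith [hx.1], by linarith [hx.2]⟩
          have hk' : (k : ℝ) ≤ n₀ := by exact_mod_cast hk.le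
          have hk0 : (0 : ℝ) ≤ k := k.cast_nonneg
          have e2 : (k : ℝ) * (k - 1) ≤ n₀ ^ 2 := by
            rw [sq, mul_sub, mul_one]
            linarith [mul_self_le_mul_self hk0 hk']
          have e3 := mul_le_mul_of_nonneg_left e2 hc.le
          linarith
      rw [Finset.sum_sub_distrib, ← Finset.mul_sum, sum_mul_pred, Finset.sum_const,
        Finset.card_range, nsmul_eq_mul] at h1
      push_cast at h1
      rw [← hmn] at h1
      linarith
    have hcube : m ^ 3 / 12 - m ^ 2 ≤ m * (m - 1) * (m - 2) / 3 := by
      have e : m * (m - 1) * (m - 2) / 3 = m ^ 3 / 3 - m ^ 2 + 2 * m / 3 := by ring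
      have h3 : 0 ≤ m ^ 3 := by positivity
      rw [e]
      linarith
    have hmain : c / 12 * m ≤ 2 * (α + β + 3) * K + R := by
      have hcc := mul_le_mul_of_nonneg_left hcube hc.le
      have e1 : c * (n₀ : ℝ) ^ 2 * m ≤ c * n₀ ^ 2 * m ^ 2 := by
        gcongr
        exact le_self_pow₀ hm two_ne_zero
      have e2 : c / 12 * m * m ^ 2 ≤ (2 * (α + β + 3) * K + R) * m ^ 2 := by
        rw [hR]
        linarith
      exact le_of_mul_le_mul_right e2 (by positivity)
    -- The kernel is at least `p₀²`, which absorbs the constant `R` for small `n`.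
    have hRK : R ≤ R / p₀ ^ 2 * K := by
      rw [div_mul_eq_mul_div, le_div_iff₀ hp₀']
      gcongr
    rw [div_mul_eq_mul_div, div_le_iff₀ (by
      have : 0 < α + β + 3 := by linarith
      positivity)]
    linarith
  · intro n x hx y hy
    refine (abs_jacobiKernel_sub_le hα hβ hη hη1 (fun n x hx => (hp n x hx).1) (hsub hx)
      (hsub hy) n).trans ?_
    rw [← hL]
    have : L ≤ C ^ 2 + L := le_add_of_nonneg_left (sq_nonneg C)
    gcongr

end

end OneVariable

/-! ### The product Jacobi measure -/

section

variable {d : ℕ} {α β : Fin d → ℝ}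

/-- The density of the product Jacobi measure. -/
def jacobiDensity (α β : Fin d → ℝ) (x : EuclideanSpace ℝ (Fin d)) : ℝ :=
  ∏ j, jacobiWeight (α j) (β j) (x j)

lemma jacobiMeasure_eq (α β : Fin d → ℝ) : jacobiMeasure α β =
    volume.withDensity fun x => ENNReal.ofReal (jacobiDensity α β x) := rfl

lemma jacobiDensity_nonneg (α β : Fin d → ℝ) (x : EuclideanSpace ℝ (Fin d)) :
    0 ≤ jacobiDensity α β x :=
  Finset.prod_nonneg fun _ _ => jacobiWeight_nonneg _ _ _

lemma measurable_jacobiDensity (α β : Fin d → ℝ) : Measurable (jacobiDensity α β) :=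
  Finset.measurable_prod _ fun j _ => (measurable_jacobiWeight (α j) (β j)).comp (by fun_prop)

lemma integrable_jacobiDensity (hα : ∀ j, -1 < α j) (hβ : ∀ j, -1 < β j) :
    Integrable (jacobiDensity α β) := by
  have h : Integrable fun y : Fin d → ℝ => ∏ j, jacobiWeight (α j) (β j) (y j) :=
    Integrable.fintype_prod fun j => integrable_jacobiWeight (hα j) (hβ j)
  exact ((EuclideanSpace.volume_preserving_symm_measurableEquiv_toLp (Fin d)).integrable_comp_emb
    (MeasurableEquiv.measurableEmbedding _)).2 h

lemma isFiniteMeasure_jacobiMeasure (hα : ∀ j, -1 < α j) (hβ : ∀ j, -1 < β j) :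
    IsFiniteMeasure (jacobiMeasure α β) :=
  isFiniteMeasure_withDensity_ofReal (integrable_jacobiDensity hα hβ).2

lemma integral_jacobiMeasure (f : EuclideanSpace ℝ (Fin d) → ℝ) :
    ∫ x, f x ∂(jacobiMeasure α β) = ∫ x, f x * jacobiDensity α β x := by
  rw [jacobiMeasure_eq, integral_withDensity_eq_integral_toReal_smul
    (measurable_jacobiDensity α β).ennreal_ofReal (by simp)]
  refine integral_congr_ae (ae_of_all _ fun x => ?_)
  simp only [smul_eq_mul]
  rw [ENNReal.toReal_ofReal (jacobiDensity_nonneg α β x), mul_comm]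

lemma integral_prod_jacobiMeasure (f : Fin d → ℝ → ℝ) :
    ∫ x, ∏ j, f j (x j) ∂(jacobiMeasure α β) =
      ∏ j, ∫ t, f j t * jacobiWeight (α j) (β j) t := by
  rw [integral_jacobiMeasure, ← integral_fintype_prod_volume_eq_prod,
    ← (EuclideanSpace.volume_preserving_symm_measurableEquiv_toLp (Fin d)).integral_comp']
  simp only [jacobiDensity, ← Finset.prod_mul_distrib]
  rfl

lemma isCompact_cube (d : ℕ) (ε : ℝ) : IsCompact (cube d ε) := by
  have h : IsCompact (Set.univ.pi fun _ : Fin d => Set.Icc (-1 + ε) (1 - ε)) :=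
    isCompact_univ_pi fun _ => isCompact_Icc
  convert h.image (PiLp.continuous_toLp 2 (fun _ : Fin d => ℝ)) using 1
  ext x
  constructor
  · intro hx
    exact ⟨x.ofLp, fun j _ => hx j, rfl⟩
  · rintro ⟨y, hy, rfl⟩ j
    exact hy j trivial

lemma isOpen_openCube (d : ℕ) : IsOpen (openCube d) := by
  have h : openCube d = ⋂ j, (fun x : EuclideanSpace ℝ (Fin d) => x j) ⁻¹' Set.Ioo (-1) 1 := by
    ext x
    simp [openCube]
  rw [h]
  exact isOpen_iInter_of_finite fun j => isOpen_Ioo.preimage (by fun_prop)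

lemma jacobiMeasure_compl_cube (α β : Fin d → ℝ) : jacobiMeasure α β (cube d 0)ᶜ = 0 := by
  rw [jacobiMeasure, withDensity_apply _ (isCompact_cube d 0).measurableSet.compl]
  refine setLIntegral_eq_zero (isCompact_cube d 0).measurableSet.compl fun x hx => ?_
  have hx' : ∃ j, x j ∉ Set.Icc (-1 : ℝ) 1 := by
    by_contra! h
    exact hx fun j => by simpa using h j
  obtain ⟨j, hj⟩ := hx'
  simp only [Pi.zero_apply]
  rw [Finset.prod_eq_zero (Finset.mem_univ j) (jacobiWeight_of_notMem hj), ENNReal.ofReal_zero]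

lemma continuous_polyEval (P : MvPolynomial (Fin d) ℝ) : Continuous (polyEval P) :=
  (MvPolynomial.continuous_eval P).comp (PiLp.continuous_ofLp 2 _)

lemma integrable_continuous_jacobiMeasure (hα : ∀ j, -1 < α j) (hβ : ∀ j, -1 < β j)
    {f : EuclideanSpace ℝ (Fin d) → ℝ} (hf : Continuous f) :
    Integrable f (jacobiMeasure α β) := by
  have := isFiniteMeasure_jacobiMeasure hα hβ
  obtain ⟨C, hC⟩ := (isCompact_cube d 0).exists_bound_of_continuousOn hf.continuousOn
  refine Integrable.of_bound hf.aestronglyMeasurable C ?_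
  filter_upwards [measure_eq_zero_iff_ae_notMem.1 (jacobiMeasure_compl_cube α β)] with x hx
  exact hC x (by simpa using hx)

lemma jacobiDensity_pos (α β : Fin d → ℝ) {x : EuclideanSpace ℝ (Fin d)} (hx : x ∈ openCube d) :
    0 < jacobiDensity α β x :=
  Finset.prod_pos fun j _ => jacobiWeight_pos (hx j)

lemma contDiffOn_jacobiDensity (α β : Fin d → ℝ) :
    ContDiffOn ℝ 1 (jacobiDensity α β) (openCube d) := by
  have h : ContDiffOn ℝ 1 (fun x : EuclideanSpace ℝ (Fin d) =>
      ∏ j, (1 - x j) ^ α j * (1 + x j) ^ β j) (openCube d) := by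
    refine contDiffOn_prod fun j _ => ContDiffOn.mul ?_ ?_
    · exact ContDiffOn.rpow_const_of_ne (by fun_prop) fun x hx => by linarith [(hx j).2]
    · exact ContDiffOn.rpow_const_of_ne (by fun_prop) fun x hx => by linarith [(hx j).1]
  refine h.congr fun x hx => Finset.prod_congr rfl fun j _ => ?_
  exact jacobiWeight_of_mem (Set.Ioo_subset_Icc_self (hx j))

lemma integral_polyEval_sq_pos (hα : ∀ j, -1 < α j) (hβ : ∀ j, -1 < β j)
    {P : MvPolynomial (Fin d) ℝ} (hP : P ≠ 0) :
    0 < ∫ x, polyEval P x ^ 2 ∂(jacobiMeasure α β) := by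
  have hc : Continuous fun x => polyEval P x ^ 2 := (continuous_polyEval P).pow 2
  refine (integral_nonneg fun x => sq_nonneg _).lt_of_ne' fun h0 => hP ?_
  rw [integral_eq_zero_iff_of_nonneg (fun x => sq_nonneg _)
    (integrable_continuous_jacobiMeasure hα hβ hc)] at h0
  have h1 : ∀ᵐ x : EuclideanSpace ℝ (Fin d), x ∈ openCube d → polyEval P x = 0 := by
    have h2 := (ae_withDensity_iff (measurable_jacobiDensity α β).ennreal_ofReal).1 h0
    filter_upwards [h2] with x hx hxc
    have h3 : ENNReal.ofReal (jacobiDensity α β x) ≠ 0 := by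
      simpa using jacobiDensity_pos α β hxc
    simpa using hx h3
  have h4 : Set.EqOn (polyEval P) 0 (openCube d) := by
    refine Measure.eqOn_open_of_ae_eq (μ := volume) ?_ (isOpen_openCube d)
      (continuous_polyEval P).continuousOn continuousOn_const
    exact (ae_restrict_iff' (isOpen_openCube d).measurableSet).2 h1
  refine MvPolynomial.funext_set (fun _ => Set.Ioo (-1 : ℝ) 1)
    (fun _ => Set.Ioo_infinite (by norm_num)) fun x hx => ?_
  simpa [polyEval] using h4 (x := WithLp.toLp 2 x) fun j => hx j trivial

end

/-! ### The graded lexicographic enumeration -/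

section

variable {d : ℕ}

lemma gradedKey_injective (d : ℕ) : Function.Injective (gradedKey d) := fun a b h => by
  have h' := congrArg (fun z => ofLex (ofLex z).2) h
  simpa [gradedKey] using h'

lemma gradedKey_le_of_le {a b : Fin d → ℕ} (h : a ≤ b) : gradedKey d a ≤ gradedKey d b := by
  rw [gradedKey, gradedKey, Prod.Lex.toLex_le_toLex]
  have h1 : Finset.univ.sup a ≤ Finset.univ.sup b := Finset.sup_mono_fun fun j _ => h j
  rcases h1.lt_or_eq with h1 | h1
  · exact Or.inl h1
  · exact Or.inr ⟨h1, Pi.toLex_monotone h⟩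

lemma gradedKey_lt_of_sup_lt {a b : Fin d → ℕ} (h : Finset.univ.sup a < Finset.univ.sup b) :
    gradedKey d a < gradedKey d b := by
  rw [gradedKey, gradedKey, Prod.Lex.toLex_lt_toLex]
  exact Or.inl h

variable [NeZero d]

lemma gradedIndex_notMem (n : ℕ) :
    gradedIndex d n ∉ Set.range fun k : Fin n => gradedIndex d k.1 := by
  conv => enter [1, 2]; rw [gradedIndex]
  exact Set.mem_compl_iff _ _ |>.1 (Function.argminOn_mem (gradedKey d)
    (Set.range fun k : Fin n => gradedIndex d k.1)ᶜ _)

lemma gradedIndex_injective (d : ℕ) [NeZero d] : Function.Injective (gradedIndex d) := by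
  have h : ∀ m n, m < n → gradedIndex d m ≠ gradedIndex d n := fun m n hmn h =>
    gradedIndex_notMem n ⟨⟨m, hmn⟩, h⟩
  intro m n hmn
  rcases lt_trichotomy m n with h1 | h1 | h1
  · exact absurd hmn (h m n h1)
  · exact h1
  · exact absurd hmn.symm (h n m h1)

lemma gradedKey_gradedIndex_le {n : ℕ} {a : Fin d → ℕ}
    (ha : a ∉ Set.range fun k : Fin n => gradedIndex d k.1) :
    gradedKey d (gradedIndex d n) ≤ gradedKey d a := by
  rw [gradedIndex]
  exact Function.argminOn_le (gradedKey d) _ ha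

/-- The first `N` multi-indices. -/
def gradedInitial (d : ℕ) [NeZero d] (N : ℕ) : Finset (Fin d → ℕ) :=
  (Finset.range N).map ⟨gradedIndex d, gradedIndex_injective d⟩

lemma card_gradedInitial (N : ℕ) : (gradedInitial d N).card = N := by
  rw [gradedInitial, Finset.card_map, Finset.card_range]

lemma mem_gradedInitial_of_lt {N : ℕ} {a b : Fin d → ℕ} (hb : b ∈ gradedInitial d N)
    (h : gradedKey d a < gradedKey d b) : a ∈ gradedInitial d N := by
  rw [gradedInitial, Finset.mem_map] at hb ⊢
  obtain ⟨n, hn, rfl⟩ := hb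
  by_contra! hc
  refine (gradedKey_gradedIndex_le (n := n) ?_).not_gt h
  rintro ⟨k, hk⟩
  exact hc k.1 (Finset.mem_range.2 (k.2.trans (Finset.mem_range.1 hn))) hk

lemma mem_gradedInitial_of_le {N : ℕ} {a b : Fin d → ℕ} (hb : b ∈ gradedInitial d N)
    (h : a ≤ b) : a ∈ gradedInitial d N := by
  rcases (gradedKey_le_of_le h).lt_or_eq with h1 | h1
  · exact mem_gradedInitial_of_lt hb h1
  · rwa [gradedKey_injective d h1]

lemma gradedIndex_mem_gradedInitial {n N : ℕ} :
    gradedIndex d n ∈ gradedInitial d N ↔ n < N := by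
  rw [gradedInitial, Finset.mem_map]
  constructor
  · rintro ⟨m, hm, h⟩
    rw [← gradedIndex_injective d h]
    exact Finset.mem_range.1 hm
  · exact fun h => ⟨n, Finset.mem_range.2 h, rfl⟩

end

/-! ### Factorization of the multivariate orthonormal polynomials -/

section

variable {d : ℕ} {α β : Fin d → ℝ} (hα : ∀ j, -1 < α j) (hβ : ∀ j, -1 < β j)

include hα hβ in
lemma integrable_polyEval_mul (P Q : MvPolynomial (Fin d) ℝ) :
    Integrable (fun x => polyEval P x * polyEval Q x) (jacobiMeasure α β) :=
  integrable_continuous_jacobiMeasure hα hβ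
    ((continuous_polyEval P).mul (continuous_polyEval Q))

include hα hβ in
lemma polyInner_sum_smul {ι : Type*} (s : Finset ι) (c : ι → ℝ)
    (P : ι → MvPolynomial (Fin d) ℝ) (Q : MvPolynomial (Fin d) ℝ) :
    polyInner (jacobiMeasure α β) (∑ i ∈ s, c i • P i) Q =
      ∑ i ∈ s, c i * polyInner (jacobiMeasure α β) (P i) Q := by
  have h : ∀ x, polyEval (∑ i ∈ s, c i • P i) x * polyEval Q x =
      ∑ i ∈ s, c i * (polyEval (P i) x * polyEval Q x) := fun x => by
    simp only [polyEval, map_sum, MvPolynomial.smul_eval, Finset.sum_mul, mul_assoc]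
  simp only [polyInner, h]
  rw [integral_finsetSum _ fun i _ => (integrable_polyEval_mul hα hβ (P i) Q).const_mul _]
  exact Finset.sum_congr rfl fun i _ => integral_const_mul _ _

/-- The products `∏ⱼ P_{kⱼ}(xⱼ)` of the monic orthogonal Jacobi polynomials. -/
def productPoly (k : Fin d → ℕ) : MvPolynomial (Fin d) ℝ :=
  ∏ j, Polynomial.aeval (MvPolynomial.X j) (monicOrth (jacobiFunctional (hα j) (hβ j)) (k j))

lemma polyEval_productPoly (k : Fin d → ℕ) (x : EuclideanSpace ℝ (Fin d)) :
    polyEval (productPoly hα hβ k) x =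
      ∏ j, (monicOrth (jacobiFunctional (hα j) (hβ j)) (k j)).eval (x j) := by
  rw [polyEval, productPoly, map_prod]
  refine Finset.prod_congr rfl fun j _ => ?_
  have h := Polynomial.hom_eval₂ (monicOrth (jacobiFunctional (hα j) (hβ j)) (k j))
    (algebraMap ℝ (MvPolynomial (Fin d) ℝ)) (MvPolynomial.eval fun j => x j) (MvPolynomial.X j)
  rw [Polynomial.aeval_def, h, MvPolynomial.eval_X]
  have he : (MvPolynomial.eval fun j => x j).comp (algebraMap ℝ (MvPolynomial (Fin d) ℝ)) =
      RingHom.id ℝ := by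
    ext
    simp
  rw [he, Polynomial.eval]

lemma polyInner_productPoly (k l : Fin d → ℕ) :
    polyInner (jacobiMeasure α β) (productPoly hα hβ k) (productPoly hα hβ l) =
      ∏ j, jacobiFunctional (hα j) (hβ j)
        (monicOrth (jacobiFunctional (hα j) (hβ j)) (k j) *
          monicOrth (jacobiFunctional (hα j) (hβ j)) (l j)) := by
  simp only [polyInner, polyEval_productPoly, ← Finset.prod_mul_distrib]
  rw [integral_prod_jacobiMeasure fun j t =>
    (monicOrth (jacobiFunctional (hα j) (hβ j)) (k j)).eval t *
      (monicOrth (jacobiFunctional (hα j) (hβ j)) (l j)).eval t]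
  simp only [jacobiFunctional_apply, Polynomial.eval_mul]

lemma polyInner_productPoly_self_pos (k : Fin d → ℕ) :
    0 < polyInner (jacobiMeasure α β) (productPoly hα hβ k) (productPoly hα hβ k) := by
  rw [polyInner_productPoly]
  exact Finset.prod_pos fun j _ =>
    monicOrth_sq_pos (fun _ => jacobiFunctional_sq_pos (hα j) (hβ j)) (k j)

lemma polyInner_productPoly_of_ne {k l : Fin d → ℕ} (h : k ≠ l) :
    polyInner (jacobiMeasure α β) (productPoly hα hβ k) (productPoly hα hβ l) = 0 := by
  obtain ⟨j, hj⟩ := Function.ne_iff.1 h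
  rw [polyInner_productPoly]
  exact Finset.prod_eq_zero (Finset.mem_univ j)
    (monicOrth_orthogonal (fun _ => jacobiFunctional_sq_pos (hα j) (hβ j)) hj)

/-- The coefficient of the product polynomial with multi-index `l` in the monomial with
multi-index `k`; it vanishes unless `l ≤ k`. -/
def productCoeff (k l : Fin d → ℕ) : ℝ :=
  if ∀ j, l j ≤ k j then ∏ j, powCoeff (jacobiFunctional (hα j) (hβ j)) (k j) (l j) else 0

lemma productCoeff_self (k : Fin d → ℕ) : productCoeff hα hβ k k = 1 := by
  simp [productCoeff]

variable [NeZero d]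

/-- A monomial is a combination of the product polynomials of its own and the preceding indices,
because the indices `l ≤ k` do not come after `k` in the graded order. -/
lemma gradedMonomial_eq_sum (n : ℕ) : gradedMonomial d n = ∑ i ∈ Finset.range (n + 1),
    productCoeff hα hβ (gradedIndex d n) (gradedIndex d i) •
      productPoly hα hβ (gradedIndex d i) := by
  set k := gradedIndex d n with hk
  have h1 : ∑ i ∈ Finset.range (n + 1), productCoeff hα hβ k (gradedIndex d i) •
      productPoly hα hβ (gradedIndex d i) =
      ∑ l ∈ gradedInitial d (n + 1), productCoeff hα hβ k l • productPoly hα hβ l := by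
    rw [gradedInitial, Finset.sum_map]
    rfl
  have hsub : Fintype.piFinset (fun j => Finset.range (k j + 1)) ⊆ gradedInitial d (n + 1) := by
    intro l hl
    refine mem_gradedInitial_of_le (gradedIndex_mem_gradedInitial.2 n.lt_succ_self) fun j => ?_
    exact Nat.lt_succ_iff.1 (Finset.mem_range.1 (Fintype.mem_piFinset.1 hl j))
  rw [h1, ← Finset.sum_subset hsub]
  · have hpow : ∀ j : Fin d, (MvPolynomial.X j : MvPolynomial (Fin d) ℝ) ^ k j =
        ∑ i ∈ Finset.range (k j + 1), powCoeff (jacobiFunctional (hα j) (hβ j)) (k j) i •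
          Polynomial.aeval (MvPolynomial.X j)
            (monicOrth (jacobiFunctional (hα j) (hβ j)) i) := fun j => by
      have := congrArg (Polynomial.aeval (MvPolynomial.X j : MvPolynomial (Fin d) ℝ))
        (X_pow_eq_sum_monicOrth (jacobiFunctional (hα j) (hβ j)) (k j))
      simpa only [map_pow, Polynomial.aeval_X, map_sum, map_smul] using this
    rw [gradedMonomial, ← hk]
    simp only [hpow]
    rw [Finset.prod_univ_sum]
    refine Finset.sum_congr rfl fun l hl => ?_
    have hle : ∀ j, l j ≤ k j := fun j =>
      Nat.lt_succ_iff.1 (Finset.mem_range.1 (Fintype.mem_piFinset.1 hl j))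
    rw [productCoeff, if_pos hle, productPoly, Finset.prod_smul]
  · intro l _ hl
    have hle : ¬ ∀ j, l j ≤ k j := fun h => hl (Fintype.mem_piFinset.2 fun j =>
      Finset.mem_range.2 (Nat.lt_succ_iff.2 (h j)))
    rw [productCoeff, if_neg hle, zero_smul]

/-- The Gram-Schmidt algorithm in the graded order yields the products of the one-dimensional
orthogonal polynomials. -/
theorem orthogonalPoly_jacobiMeasure (n : ℕ) :
    orthogonalPoly (jacobiMeasure α β) n = productPoly hα hβ (gradedIndex d n) := by
  induction n using Nat.strong_induction_on with
  | _ n ih =>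
  have hsum : ∑ k : Fin n, (polyInner (jacobiMeasure α β) (gradedMonomial d n)
        (orthogonalPoly (jacobiMeasure α β) k.1) /
      polyInner (jacobiMeasure α β) (orthogonalPoly (jacobiMeasure α β) k.1)
        (orthogonalPoly (jacobiMeasure α β) k.1)) • orthogonalPoly (jacobiMeasure α β) k.1 =
      ∑ k ∈ Finset.range n, productCoeff hα hβ (gradedIndex d n) (gradedIndex d k) •
        productPoly hα hβ (gradedIndex d k) := by
    rw [← Fin.sum_univ_eq_sum_range (fun k => productCoeff hα hβ (gradedIndex d n)
      (gradedIndex d k) • productPoly hα hβ (gradedIndex d k))]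
    refine Finset.sum_congr rfl fun k _ => ?_
    rw [ih k.1 k.2, gradedMonomial_eq_sum hα hβ, polyInner_sum_smul hα hβ,
      Finset.sum_eq_single k.1]
    · rw [mul_div_cancel_right₀ _ (polyInner_productPoly_self_pos hα hβ _).ne']
    · intro i _ hi
      rw [polyInner_productPoly_of_ne hα hβ fun h => hi (gradedIndex_injective d h), mul_zero]
    · exact fun h => absurd (Finset.mem_range.2 (k.2.trans n.lt_succ_self)) h
  rw [orthogonalPoly, hsum, gradedMonomial_eq_sum hα hβ, Finset.sum_range_succ,
    productCoeff_self, one_smul, add_sub_cancel_left]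

lemma polyEval_orthonormalPoly (n : ℕ) (x : EuclideanSpace ℝ (Fin d)) :
    polyEval (orthonormalPoly (jacobiMeasure α β) n) x =
      ∏ j, (jacobiPoly (hα j) (hβ j) (gradedIndex d n j)).eval (x j) := by
  rw [orthonormalPoly, orthogonalPoly_jacobiMeasure hα hβ, polyEval, MvPolynomial.smul_eval,
    ← polyEval, polyEval_productPoly, polyInner_productPoly, Real.sqrt_prod _ fun j _ =>
    (monicOrth_sq_pos (fun _ => jacobiFunctional_sq_pos (hα j) (hβ j)) _).le,
    ← Finset.prod_inv_distrib, ← Finset.prod_mul_distrib]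
  refine Finset.prod_congr rfl fun j _ => ?_
  rw [jacobiPoly, orthonormal, Polynomial.eval_smul, smul_eq_mul]

/-- The diagonal of the Christoffel-Darboux kernel. -/
lemma cdKernel_self (N : ℕ) (x : EuclideanSpace ℝ (Fin d)) :
    cdKernel (jacobiMeasure α β) N x x = ∑ k ∈ gradedInitial d N,
      ∏ j, (jacobiPoly (hα j) (hβ j) (k j)).eval (x j) ^ 2 := by
  rw [cdKernel, gradedInitial, Finset.sum_map]
  refine Finset.sum_congr rfl fun n _ => ?_
  rw [polyEval_orthonormalPoly hα hβ, ← sq, ← Finset.prod_pow]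
  rfl

end

/-! ### Sums of products over lower sets of multi-indices -/

section

variable {d : ℕ} {S : Finset (Fin d → ℕ)} {M : ℕ}

/-- A line parallel to a coordinate axis meets a finite lower set in an initial segment. -/
lemma exists_update_mem_iff (hS : ∀ b ∈ S, ∀ a ≤ b, a ∈ S) (hM : ∀ k ∈ S, ∀ j, k j ≤ M)
    (k : Fin d → ℕ) (j : Fin d) :
    ∃ m ≤ M + 1, ∀ n, Function.update k j n ∈ S ↔ n < m := by
  have hex : ∃ n, Function.update k j n ∉ S :=
    ⟨M + 1, fun h => by simpa using hM _ h j⟩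
  classical
  refine ⟨Nat.find hex, Nat.find_min' hex fun h => by simpa using hM _ h j, fun n => ?_⟩
  constructor
  · intro h
    by_contra! hn
    exact Nat.find_spec hex (hS _ h _ (update_le_update_iff.2 ⟨hn, fun _ _ => le_rfl⟩))
  · exact fun h => not_not.1 (Nat.find_min hex h)

/-- Changing one variable of a sum of products over a lower set. Along the lines parallel to the
corresponding axis, the sums are the kernels of one variable. -/
lemma abs_sum_prod_update_sub_le (hS : ∀ b ∈ S, ∀ a ≤ b, a ∈ S) (hM : ∀ k ∈ S, ∀ j, k j ≤ M)
    {g : Fin d → ℕ → ℝ → ℝ} {I : Set ℝ} {C : ℝ} (hC : 0 ≤ C) (hg0 : ∀ j n t, 0 ≤ g j n t)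
    (hg : ∀ j n, ∀ t ∈ I, g j n t ≤ C)
    (hlip : ∀ j n, ∀ s ∈ I, ∀ t ∈ I, |∑ k ∈ Finset.range n, g j k s -
      ∑ k ∈ Finset.range n, g j k t| ≤ C * n * |s - t|)
    {x : Fin d → ℝ} (hx : ∀ i, x i ∈ I) (j : Fin d) {t : ℝ} (ht : t ∈ I) :
    |∑ k ∈ S, ∏ i, g i (k i) (Function.update x j t i) - ∑ k ∈ S, ∏ i, g i (k i) (x i)| ≤
      C ^ d * ((M : ℝ) + 1) ^ d * |t - x j| := by
  classical
  choose m hmM hm using fun k => exists_update_mem_iff hS hM k j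
  -- The lines parallel to the axis `j` are indexed by their points with `j`-th entry zero.
  set T : Finset (Fin d → ℕ) :=
    Fintype.piFinset fun i => if i = j then {0} else Finset.range (M + 1) with hT
  have hd : d - 1 + 1 = d := Nat.sub_add_cancel j.pos
  have hTcard : T.card = (M + 1) ^ (d - 1) := by
    rw [hT, Fintype.card_piFinset, ← Finset.mul_prod_erase _ _ (Finset.mem_univ j), if_pos rfl,
      Finset.card_singleton, one_mul, Finset.prod_congr rfl fun i hi => by
        rw [if_neg (Finset.ne_of_mem_erase hi), Finset.card_range],
      Finset.prod_const, Finset.card_erase_of_mem (Finset.mem_univ j), Finset.card_univ,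
      Fintype.card_fin]
  have hmaps : ∀ k ∈ S, Function.update k j 0 ∈ T := by
    intro k hk
    refine Fintype.mem_piFinset.2 fun i => ?_
    by_cases hi : i = j
    · subst hi
      simp
    · rw [if_neg hi, Function.update_of_ne hi, Finset.mem_range]
      exact Nat.lt_succ_of_le (hM k hk i)
  have hfiber : ∀ z : Fin d → ℝ, ∑ k ∈ S, ∏ i, g i (k i) (z i) =
      ∑ k ∈ T, (∏ i ∈ Finset.univ.erase j, g i (k i) (z i)) *
        ∑ n ∈ Finset.range (m k), g j n (z j) := by
    intro z
    rw [← Finset.sum_fiberwise_of_maps_to hmaps]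
    refine Finset.sum_congr rfl fun k hk => ?_
    have hkj : k j = 0 := by simpa using Fintype.mem_piFinset.1 hk j
    rw [Finset.mul_sum]
    refine Finset.sum_nbij' (fun l => l j) (fun n => Function.update k j n) ?_ ?_ ?_ ?_ ?_
    · intro l hl
      obtain ⟨hl1, rfl⟩ := Finset.mem_filter.1 hl
      rw [Finset.mem_range, ← hm]
      simpa using hl1
    · intro n hn
      refine Finset.mem_filter.2 ⟨(hm k n).2 (Finset.mem_range.1 hn), ?_⟩
      rw [Function.update_idem, ← hkj, Function.update_eq_self]
    · intro l hl
      obtain ⟨hl1, rfl⟩ := Finset.mem_filter.1 hl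
      simp
    · intro n _
      simp
    · intro l hl
      obtain ⟨hl1, rfl⟩ := Finset.mem_filter.1 hl
      rw [← Finset.mul_prod_erase _ _ (Finset.mem_univ j), mul_comm]
      congr 1
      exact Finset.prod_congr rfl fun i hi => by
        rw [Function.update_of_ne (Finset.ne_of_mem_erase hi)]
  rw [hfiber, hfiber, ← Finset.sum_sub_distrib]
  have hterm : ∀ k ∈ T, |(∏ i ∈ Finset.univ.erase j, g i (k i) (Function.update x j t i)) *
        ∑ n ∈ Finset.range (m k), g j n (Function.update x j t j) -
      (∏ i ∈ Finset.univ.erase j, g i (k i) (x i)) *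
        ∑ n ∈ Finset.range (m k), g j n (x j)| ≤
      C ^ (d - 1) * (C * ((M : ℝ) + 1) * |t - x j|) := by
    intro k _
    have h1 : ∏ i ∈ Finset.univ.erase j, g i (k i) (Function.update x j t i) =
        ∏ i ∈ Finset.univ.erase j, g i (k i) (x i) :=
      Finset.prod_congr rfl fun i hi => by
        rw [Function.update_of_ne (Finset.ne_of_mem_erase hi)]
    have h2 : ∏ i ∈ Finset.univ.erase j, g i (k i) (x i) ≤ C ^ (d - 1) := by
      refine (Finset.prod_le_prod (fun i _ => hg0 _ _ _)
        fun i _ => hg i (k i) (x i) (hx i)).trans_eq ?_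
      rw [Finset.prod_const, Finset.card_erase_of_mem (Finset.mem_univ j), Finset.card_univ,
        Fintype.card_fin]
    rw [h1, Function.update_self, ← mul_sub, abs_mul,
      abs_of_nonneg (Finset.prod_nonneg fun i _ => hg0 _ _ _)]
    refine mul_le_mul h2 ((hlip j (m k) t ht (x j) (hx j)).trans ?_) (abs_nonneg _)
      (pow_nonneg hC _)
    have : (m k : ℝ) ≤ M + 1 := by exact_mod_cast hmM k
    gcongr
  refine (Finset.abs_sum_le_sum_abs _ _).trans ((Finset.sum_le_card_nsmul _ _ _ hterm).trans_eq ?_)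
  rw [hTcard, nsmul_eq_mul]
  nth_rewrite 3 4 [← hd]
  push_cast
  ring

lemma abs_sum_prod_sub_le (hS : ∀ b ∈ S, ∀ a ≤ b, a ∈ S) (hM : ∀ k ∈ S, ∀ j, k j ≤ M)
    {g : Fin d → ℕ → ℝ → ℝ} {I : Set ℝ} {C : ℝ} (hC : 0 ≤ C) (hg0 : ∀ j n t, 0 ≤ g j n t)
    (hg : ∀ j n, ∀ t ∈ I, g j n t ≤ C)
    (hlip : ∀ j n, ∀ s ∈ I, ∀ t ∈ I, |∑ k ∈ Finset.range n, g j k s -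
      ∑ k ∈ Finset.range n, g j k t| ≤ C * n * |s - t|)
    {x y : Fin d → ℝ} (hx : ∀ i, x i ∈ I) (hy : ∀ i, y i ∈ I) :
    |∑ k ∈ S, ∏ i, g i (k i) (x i) - ∑ k ∈ S, ∏ i, g i (k i) (y i)| ≤
      C ^ d * ((M : ℝ) + 1) ^ d * ∑ j, |x j - y j| := by
  classical
  -- The coordinates of `y` are replaced by those of `x` one after the other.
  have key : ∀ s : Finset (Fin d),
      |∑ k ∈ S, ∏ i, g i (k i) (s.piecewise x y i) - ∑ k ∈ S, ∏ i, g i (k i) (y i)| ≤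
        C ^ d * ((M : ℝ) + 1) ^ d * ∑ j ∈ s, |x j - y j| := by
    intro s
    induction s using Finset.induction_on with
    | empty => simp
    | insert j s hj ih =>
      have hz : ∀ i, s.piecewise x y i ∈ I := fun i => by
        by_cases hi : i ∈ s
        · rw [Finset.piecewise_eq_of_mem _ _ _ hi]
          exact hx i
        · rw [Finset.piecewise_eq_of_notMem _ _ _ hi]
          exact hy i
      have h := abs_sum_prod_update_sub_le hS hM hC hg0 hg hlip hz j (hx j)
      rw [Finset.piecewise_eq_of_notMem _ _ _ hj] at h
      rw [Finset.piecewise_insert, Finset.sum_insert hj, mul_add]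
      exact (abs_sub_le _ _ _).trans (add_le_add h ih)
  simpa using key Finset.univ

lemma le_sum_prod {m : ℕ} (hm : ∀ a : Fin d → ℕ, (∀ j, a j < m) → a ∈ S)
    {g : Fin d → ℕ → ℝ → ℝ} {c : ℝ} (hc : 0 ≤ c) (hg0 : ∀ j n t, 0 ≤ g j n t) {x : Fin d → ℝ}
    (hx : ∀ j, c * m ≤ ∑ k ∈ Finset.range m, g j k (x j)) :
    c ^ d * (m : ℝ) ^ d ≤ ∑ k ∈ S, ∏ i, g i (k i) (x i) := by
  have hsub : Fintype.piFinset (fun _ : Fin d => Finset.range m) ⊆ S := fun a ha =>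
    hm a fun j => Finset.mem_range.1 (Fintype.mem_piFinset.1 ha j)
  refine le_trans ?_ (Finset.sum_le_sum_of_subset_of_nonneg hsub fun k _ _ =>
    Finset.prod_nonneg fun i _ => hg0 _ _ _)
  rw [← Finset.prod_univ_sum (fun _ : Fin d => Finset.range m) fun i n => g i n (x i), ← mul_pow]
  refine le_trans (by simp) (Finset.prod_le_prod (s := Finset.univ) (f := fun _ => c * (m : ℝ))
    (fun _ _ => by positivity) fun j _ => hx j)

end

/-! ### The regularity assumption -/

section

variable {d : ℕ} [NeZero d]

/-- The first `N` multi-indices contain a cube and are contained in a cube of comparable size. -/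
lemma exists_gradedInitial_bounds {N : ℕ} (hN : N ≠ 0) : ∃ M m : ℕ, M + 1 ≤ 2 * m ∧
    N ≤ (M + 1) ^ d ∧ (∀ k ∈ gradedInitial d N, ∀ j, k j ≤ M) ∧
      ∀ a : Fin d → ℕ, (∀ j, a j < m) → a ∈ gradedInitial d N := by
  have hne : (gradedInitial d N).Nonempty := by
    rw [← Finset.card_pos, card_gradedInitial]
    exact Nat.pos_of_ne_zero hN
  set M := (gradedInitial d N).sup fun k => Finset.univ.sup k with hM
  have hle : ∀ k ∈ gradedInitial d N, ∀ j, k j ≤ M := fun k hk j =>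
    (Finset.le_sup (f := k) (Finset.mem_univ j)).trans
      (Finset.le_sup (f := fun k : Fin d → ℕ => Finset.univ.sup k) hk)
  -- For `N = 1` the largest entry `M` is zero, whereas the cube of side one is contained.
  refine ⟨M, max M 1, by omega, ?_, hle, fun a ha => ?_⟩
  · have hsub : gradedInitial d N ⊆ Fintype.piFinset fun _ => Finset.range (M + 1) :=
      fun k hk => Fintype.mem_piFinset.2 fun j =>
        Finset.mem_range.2 (Nat.lt_succ_of_le (hle k hk j))
    have h := Finset.card_le_card hsub
    rw [card_gradedInitial, Fintype.card_piFinset] at h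
    simpa using h
  · obtain ⟨b, hb, hbM⟩ := Finset.exists_mem_eq_sup _ hne fun k : Fin d → ℕ => Finset.univ.sup k
    rw [← hM] at hbM
    rcases Nat.eq_zero_or_pos M with h0 | h0
    · refine mem_gradedInitial_of_le hb fun j => ?_
      have h1 : a j = 0 := by simpa [h0] using ha j
      exact h1 ▸ Nat.zero_le _
    · refine mem_gradedInitial_of_lt hb (gradedKey_lt_of_sup_lt ?_)
      rw [← hbM, Finset.sup_lt_iff h0]
      intro j _
      have := ha j
      omega

variable {α β : Fin d → ℝ} (hα : ∀ j, -1 < α j) (hβ : ∀ j, -1 < β j)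

include hα hβ in
/-- The functions `N / K_N(x, x)` are Lipschitz continuous inside the cube, uniformly in `N`. -/
theorem exists_abs_rateOfChange_le {ε : ℝ} (hε : 0 < ε) : ∃ C : ℝ, ∀ N : ℕ,
    ∀ x ∈ cube d ε, ∀ y ∈ cube d ε, |rateOfChange (jacobiMeasure α β) N x y| ≤ C := by
  choose C' c' hC' hc' hbd hlow hlip using fun j =>
    exists_jacobiKernel_bounds (hα j) (hβ j) hε
  obtain ⟨j₁, -, hj₁⟩ := Finset.exists_max_image Finset.univ C' Finset.univ_nonempty
  obtain ⟨j₂, -, hj₂⟩ := Finset.exists_min_image Finset.univ c' Finset.univ_nonempty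
  set C := C' j₁ with hC
  set c := c' j₂ with hc
  have hC0 : 0 < C := hC' j₁
  have hc0 : 0 < c := hc' j₂
  set b := (c / 2) ^ d with hb
  have hb0 : 0 < b := by positivity
  set g : Fin d → ℕ → ℝ → ℝ := fun j n t => (jacobiPoly (hα j) (hβ j) n).eval t ^ 2 with hg
  have hg0 : ∀ j n t, 0 ≤ g j n t := fun j n t => sq_nonneg _
  refine ⟨C ^ d * d / b ^ 2, fun N x hx y hy => ?_⟩
  rcases eq_or_ne N 0 with rfl | hN
  -- For `N = 0` the kernel is zero and both quotients are `0 / 0 = 0`.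
  · simp only [rateOfChange, Nat.cast_zero, zero_div, sub_zero, abs_zero]
    positivity
  obtain ⟨M, m, hMm, hNM, hM, hm⟩ := exists_gradedInitial_bounds (d := d) hN
  have hm0 : m ≠ 0 := by omega
  set Q : ℝ := ((M : ℝ) + 1) ^ d with hQ
  have hQ0 : 0 < Q := by positivity
  have hNQ : (N : ℝ) ≤ Q := by
    rw [hQ]
    exact_mod_cast hNM
  have hlower : ∀ z ∈ cube d ε, b * Q ≤ cdKernel (jacobiMeasure α β) N z z := by
    intro z hz
    rw [cdKernel_self hα hβ]
    refine le_trans ?_ (le_sum_prod hm hc0.le hg0 (x := z) fun j => ?_)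
    · rw [hb, hQ, ← mul_pow, ← mul_pow]
      have : (M : ℝ) + 1 ≤ 2 * m := by exact_mod_cast hMm
      have h2 : c / 2 * ((M : ℝ) + 1) ≤ c / 2 * (2 * m) := by gcongr
      have h3 : c / 2 * (2 * (m : ℝ)) = c * m := by ring
      rw [h3] at h2
      gcongr
    · obtain ⟨n, rfl⟩ := Nat.exists_eq_succ_of_ne_zero hm0
      have h := hlow j n (z j) (hz j)
      rw [eval_jacobiKernel] at h
      refine le_trans ?_ h
      push_cast
      have := hj₂ j (Finset.mem_univ j)
      gcongr
  have hupper : |cdKernel (jacobiMeasure α β) N y y - cdKernel (jacobiMeasure α β) N x x| ≤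
      C ^ d * Q * (d * ‖x - y‖) := by
    rw [cdKernel_self hα hβ, cdKernel_self hα hβ]
    refine (abs_sum_prod_sub_le (fun b hb a hab => mem_gradedInitial_of_le hb hab) hM hC0.le hg0
      (I := Set.Icc (-1 + ε) (1 - ε)) (fun j n t ht => ?_) (fun j n s hs t ht => ?_)
      (x := y) (y := x) hy hx).trans ?_
    · exact (hbd j n t ht).trans (hj₁ j (Finset.mem_univ j))
    · have h := hlip j n s hs t ht
      rw [eval_jacobiKernel, eval_jacobiKernel] at h
      refine h.trans ?_
      have := hj₁ j (Finset.mem_univ j)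
      gcongr
    · refine mul_le_mul_of_nonneg_left ?_ (by positivity)
      refine (Finset.sum_le_card_nsmul _ _ ‖x - y‖ fun j _ => ?_).trans_eq (by simp)
      have h := PiLp.norm_apply_le (x - y) j
      rwa [PiLp.sub_apply, Real.norm_eq_abs, abs_sub_comm] at h
  have hx1 := hlower x hx
  have hy1 := hlower y hy
  set Kx := cdKernel (jacobiMeasure α β) N x x
  set Ky := cdKernel (jacobiMeasure α β) N y y
  have hbQ : 0 < b * Q := by positivity
  have hKx : 0 < Kx := hbQ.trans_le hx1
  have hKy : 0 < Ky := hbQ.trans_le hy1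
  rw [rateOfChange, abs_div, abs_norm]
  refine div_le_of_le_mul₀ (norm_nonneg _) (by positivity) ?_
  have he : (N : ℝ) / Kx - N / Ky = N * (Ky - Kx) / (Kx * Ky) := by
    field_simp
  change |(N : ℝ) / Kx - N / Ky| ≤ _
  rw [he, abs_div, abs_mul, Nat.abs_cast, abs_of_pos (mul_pos hKx hKy),
    div_le_iff₀ (mul_pos hKx hKy)]
  calc (N : ℝ) * |Ky - Kx| ≤ Q * (C ^ d * Q * (d * ‖x - y‖)) := by gcongr
    _ = C ^ d * d / b ^ 2 * ‖x - y‖ * (b * Q * (b * Q)) := by field_simp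
    _ ≤ C ^ d * d / b ^ 2 * ‖x - y‖ * (Kx * Ky) := by gcongr

lemma truncatedEnergy_eq_zero {μ : Measure (EuclideanSpace ℝ (Fin d))} {ε C : ℝ} {N : ℕ}
    (h : ∀ x ∈ cube d ε, ∀ y ∈ cube d ε, |rateOfChange μ N x y| ≤ C) (δ : ℝ) :
    truncatedEnergy μ ε C δ N = 0 := by
  have hc : IsClosed (cube d ε) := (isCompact_cube d ε).isClosed
  refine setLIntegral_eq_zero ?_ fun z hz => ?_
  · refine IsClosed.measurableSet (IsClosed.inter (hc.preimage continuous_fst)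
      (IsClosed.inter (hc.preimage continuous_snd) ?_))
    exact isClosed_le (continuous_fst.sub continuous_snd).norm continuous_const
  · have hz' : z ∉ {z | C < |rateOfChange μ N z.1 z.2|} := fun hz' =>
      (h _ hz.1 _ hz.2.1).not_gt hz'
    exact Set.indicator_of_notMem hz' _

include hα hβ in
theorem regularityAssumption_jacobiMeasure : RegularityAssumption (jacobiMeasure α β) := by
  intro ε hε _
  obtain ⟨C₀, hC₀⟩ := exists_abs_rateOfChange_le hα hβ hε
  refine tendsto_const_nhds.congr' ?_
  filter_upwards [eventually_ge_atTop C₀] with C hC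
  have h : ∀ δ N, truncatedEnergy (jacobiMeasure α β) ε C δ N = 0 := fun δ N =>
    truncatedEnergy_eq_zero (fun x hx y hy => (hC₀ N x hx y hy).trans hC) δ
  simp [h]

end

end JacobiOPE

end

theorem mainTheorem6 (d : ℕ) [NeZero d] (α β : Fin d → ℝ)
    (hα : ∀ j, -1 < α j) (hβ : ∀ j, -1 < β j) :
    JacobiOPE.CLTAssumptions (fun j => JacobiOPE.jacobiWeight (α j) (β j))
      (JacobiOPE.jacobiMeasure α β) where
  density_measurable j := JacobiOPE.measurable_jacobiWeight (α j) (β j)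
  density_nonneg j t := JacobiOPE.jacobiWeight_nonneg (α j) (β j) t
  eq_withDensity := rfl
  finite := JacobiOPE.isFiniteMeasure_jacobiMeasure hα hβ
  supported := JacobiOPE.jacobiMeasure_compl_cube α β
  nondegenerate P hP := ⟨JacobiOPE.integrable_continuous_jacobiMeasure hα hβ
    ((JacobiOPE.continuous_polyEval P).pow 2), JacobiOPE.integral_polyEval_sq_pos hα hβ hP⟩
  density_contDiffOn := JacobiOPE.contDiffOn_jacobiDensity α β
  density_pos _ hx := JacobiOPE.jacobiDensity_pos α β hx
  regular := JacobiOPE.regularityAssumption_jacobiMeasure hα hβ
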